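/- **Theorem (Cayley–Sylvester).** Let $d,g\ge 0$ be integers. Let $a_0,\dots,a_d$ be the coefficients of a binary form $f=\sum_{i=0}^d\binom di a_i x^{d-i}y^i$; the polynomials in $a_0,\dots,a_d$ that are homogeneous of degree $g$ form the space $S^g(S^d\mathbb C^2)$, where $a_i$ corresponds to $e_0^{d-i}e_1^{i}\in S^d\mathbb C^2$ ($e_0,e_1$ the standard basis of $\mathbb C^2$), with its natural action of $SL(2)=SL(2,\mathbb C)$. For an integer $p\ge 0$ let $H_{g,p,d}$ be the span of the monomials $a_0^{\nu_0}\cdots a_d^{\nu_d}$ with $\sum_i\nu_i=g$ and $\sum_i i\,\nu_i=p$, let $$D=\sum_{i=0}^{d-1}(i+1)\,a_i\frac{\partial}{\partial a_{i+1}},$$ and let $I_{g,p,d}$ be the kernel of $D$ on $H_{g,p,d}$. Put $$C_{g,d}(x)=\frac{\prod_{i=1}^{g}(1-x^{d+i})}{\prod_{i=2}^{g}(1-x^{i})}$$ (empty products being $1$), regarded as a power series in $x$. (i) If $p\le \frac{dg}{2}$, then $\dim I_{g,p,d}$ is the coefficient of $x^p$ in $C_{g,d}(x)$. (ii) If $2p=dg$,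 then $I_{g,p,d}$ is the space $S^g(S^d\mathbb C^2)^{SL(2)}$ of invariants of degree $g$ of binary forms of degree $d$; hence the dimension of this space is the coefficient of $x^{dg/2}$ in $C_{g,d}(x)$. (iii) There is an isomorphism of representations of $SL(2)$ $$S^g(S^d\mathbb C^2)\;\cong\;\bigoplus_{e} S^e\mathbb C^2\otimes I_{g,\frac{dg-e}{2},d},$$ where $e$ runs over the integers $0\le e\le dg$ with $e\equiv dg \pmod 2$ and $SL(2)$ acts trivially on the second factors; and for each such $e$ the multiplicity $\dim I_{g,\frac{dg-e}{2},d}$ of $S^e\mathbb C^2$ is the coefficient of $x^{\frac{dg-e}{2}}$ in $C_{g,d}(x)$. -/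

import Mathlib

open scoped TensorProduct DirectSum MatrixGroups

noncomputable section

namespace CayleySylvester

section SymmetricPowers

variable {G V W U : Type*} [Group G] [AddCommGroup V] [Module ℂ V] [AddCommGroup W] [Module ℂ W]
  [AddCommGroup U] [Module ℂ U]

/-- The symmetric power `S^n V`: the degree `n` component of the symmetric algebra of `V`. -/
abbrev symPow (n : ℕ) (V : Type*) [AddCommGroup V] [Module ℂ V] :
    Submodule ℂ (SymmetricAlgebra ℂ V) :=
  LinearMap.range (SymmetricAlgebra.ι ℂ V) ^ n

/-- The algebra homomorphism of symmetric algebras induced by a linear map. -/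
def symAlgMap (f : V →ₗ[ℂ] W) : SymmetricAlgebra ℂ V →ₐ[ℂ] SymmetricAlgebra ℂ W :=
  SymmetricAlgebra.lift (SymmetricAlgebra.ι ℂ W ∘ₗ f)

theorem symAlgMap_ι (f : V →ₗ[ℂ] W) (v : V) :
    symAlgMap f (SymmetricAlgebra.ι ℂ V v) = SymmetricAlgebra.ι ℂ W (f v) := by
  simp [symAlgMap]

theorem symAlgMap_one : symAlgMap (1 : V →ₗ[ℂ] V) = AlgHom.id ℂ _ := by
  apply SymmetricAlgebra.algHom_ext
  ext v
  simp [symAlgMap_ι]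

theorem symAlgMap_comp (f : W →ₗ[ℂ] U) (g : V →ₗ[ℂ] W) :
    symAlgMap (f ∘ₗ g) = (symAlgMap f).comp (symAlgMap g) := by
  apply SymmetricAlgebra.algHom_ext
  ext v
  simp [symAlgMap_ι]

theorem symPow_le_comap (n : ℕ) (f : V →ₗ[ℂ] W) :
    symPow n V ≤ (symPow n W).comap (symAlgMap f).toLinearMap := by
  rw [← Submodule.map_le_iff_le_comap, symPow, Submodule.map_pow]
  refine pow_le_pow_left' ?_ n
  rintro _ ⟨_, ⟨v, rfl⟩, rfl⟩
  exact ⟨f v, (symAlgMap_ι f v).symm⟩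

/-- The action of a group on the symmetric algebra of one of its representations,
by algebra automorphisms. -/
def symAlgRep (ρ : Representation ℂ G V) : Representation ℂ G (SymmetricAlgebra ℂ V) where
  toFun γ := (symAlgMap (ρ γ)).toLinearMap
  map_one' := by
    rw [map_one, symAlgMap_one]
    rfl
  map_mul' γ δ := by
    rw [map_mul, Module.End.mul_eq_comp, symAlgMap_comp]
    rfl

/-- The representation `S^n V` of `G` induced by a representation `V`. -/
def symPowRep (n : ℕ) (ρ : Representation ℂ G V) : Representation ℂ G (symPow n V) :=
  (symAlgRep ρ).subrepresentation (symPow n V) fun γ => symPow_le_comap n (ρ γ)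

end SymmetricPowers

section SL2

/-- The standard representation of `SL(2, ℂ)` on `ℂ²`. -/
def stdRep : Representation ℂ SL(2, ℂ) (Fin 2 → ℂ) where
  toFun γ := Matrix.toLin' (γ : Matrix (Fin 2) (Fin 2) ℂ)
  map_one' := by
    rw [Matrix.SpecialLinearGroup.coe_one, Matrix.toLin'_one]
    rfl
  map_mul' γ δ := by
    rw [Matrix.SpecialLinearGroup.coe_mul, Matrix.toLin'_mul]
    rfl

/-- The space `S^d ℂ²`. -/
abbrev SymC2 (d : ℕ) : Type := symPow d (Fin 2 → ℂ)

/-- The action of `SL(2, ℂ)` on `S^d ℂ²`. -/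
abbrev symC2Rep (d : ℕ) : Representation ℂ SL(2, ℂ) (SymC2 d) := symPowRep d stdRep

/-- The space `S^g (S^d ℂ²)`. -/
abbrev Plethysm (g d : ℕ) : Type := symPow g (SymC2 d)

/-- The action of `SL(2, ℂ)` on `S^g (S^d ℂ²)`. -/
abbrev plethysmRep (g d : ℕ) : Representation ℂ SL(2, ℂ) (Plethysm g d) :=
  symPowRep g (symC2Rep d)

end SL2

section Coefficients

/-- The element `e₀^(d-i) e₁^i` of `S^d ℂ²`. It is the coefficient `aᵢ` of the binary form
`f = ∑ᵢ (d choose i) aᵢ x^(d-i) y^i`: a form of degree `d` on `ℂ²` is a linear function on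
`S^d ℂ²`, and `aᵢ(f)` is its value at `e₀^(d-i) e₁^i`. -/
def coeffVector (d : ℕ) (i : Fin (d + 1)) : SymC2 d :=
  ⟨SymmetricAlgebra.ι ℂ (Fin 2 → ℂ) (Pi.single 0 1) ^ (d - (i : ℕ)) *
      SymmetricAlgebra.ι ℂ (Fin 2 → ℂ) (Pi.single 1 1) ^ (i : ℕ), by
    have h : d = (d - (i : ℕ)) + (i : ℕ) := (Nat.sub_add_cancel (Nat.lt_succ_iff.mp i.2)).symm
    have h' : symPow d (Fin 2 → ℂ) =
        symPow (d - (i : ℕ)) (Fin 2 → ℂ) * symPow (i : ℕ) (Fin 2 → ℂ) := by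
      conv_lhs => rw [h]
      exact pow_add _ _ _
    rw [h']
    exact Submodule.mul_mem_mul (Submodule.pow_mem_pow _ (LinearMap.mem_range_self _ _) _)
      (Submodule.pow_mem_pow _ (LinearMap.mem_range_self _ _) _)⟩

/-- The identification of polynomials in the coefficients `a₀, …, a_d` of a binary form of degree
`d` with elements of the symmetric algebra of `S^d ℂ²`. -/
def ofCoeffs (d : ℕ) :
    MvPolynomial (Fin (d + 1)) ℂ →ₐ[ℂ] SymmetricAlgebra ℂ (SymC2 d) :=
  MvPolynomial.aeval fun i => SymmetricAlgebra.ι ℂ (SymC2 d) (coeffVector d i)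

/-- `H_{g,p,d}`: the polynomials in `a₀, …, a_d` that are homogeneous of degree `g` and isobaric of
weight `p`, where `aᵢ` has weight `i`. -/
def weightSpace (g p d : ℕ) : Submodule ℂ (MvPolynomial (Fin (d + 1)) ℂ) :=
  MvPolynomial.homogeneousSubmodule (Fin (d + 1)) ℂ g ⊓
    MvPolynomial.weightedHomogeneousSubmodule ℂ (fun i : Fin (d + 1) => (i : ℕ)) p

/-- The operator `D = ∑_{i=0}^{d-1} (i+1) aᵢ ∂/∂aᵢ₊₁`. -/
def opD (d : ℕ) :
    Derivation ℂ (MvPolynomial (Fin (d + 1)) ℂ) (MvPolynomial (Fin (d + 1)) ℂ) :=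
  ∑ i : Fin d, (MvPolynomial.C (((i : ℕ) : ℂ) + 1) * MvPolynomial.X i.castSucc) •
    MvPolynomial.pderiv i.succ

/-- `I_{g,p,d}`: the kernel of `D` on `H_{g,p,d}`. -/
def kerD (g p d : ℕ) : Submodule ℂ (MvPolynomial (Fin (d + 1)) ℂ) :=
  weightSpace g p d ⊓ LinearMap.ker (opD d).toLinearMap

/-- The power series `(1-x^(d+1))⋯(1-x^(d+g)) / ((1-x^2)⋯(1-x^g))`. -/
def csSeries (g d : ℕ) : PowerSeries ℚ :=
  (∏ i ∈ Finset.Icc 1 g, (1 - PowerSeries.X ^ (d + i))) *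
    (∏ i ∈ Finset.Icc 2 g, (1 - PowerSeries.X ^ i))⁻¹

/-- The exponents `e` for which `(dg - e)/2` is a nonnegative integer. -/
abbrev Exponent (g d : ℕ) : Type := {e : ℕ // e ≤ d * g ∧ Even (d * g - e)}

end Coefficients

end CayleySylvester

end

open CayleySylvester

/-! The operator `opD` is the raising operator of an action of the Lie algebra sl(2) on polynomials
in the coefficients. With the lowering operator `opF`, its commutator is `d • opN - 2 • opW`, which
acts on degree `g` and weight `p` as the scalar `dg - 2p`. Thus `kerD` consists of highest weight
vectors.

Dimensions: below the middle weight, `opD` maps weight `p + 1` onto weight `p`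
(`map_opD_weightSpace`), so `dim I_{g,p,d}` is the difference of two consecutive dimensions of
weight spaces. These dimensions are the coefficients of a Gaussian binomial (`gaussSeries_mul`), and
multiplying by `1 - X` takes the differences.

Passage to the group: `SL(2, ℂ)` is generated by unipotent matrices (`sl2_induction`). Upper ones
act as the exponential of `opD` (`upperAct_of_string`), and conjugation by the Weyl element gives
the lower ones with `opF`. A vector of `SL(2)`-weight `0` killed by `opD` is also killed by `opF`,
hence invariant; conversely an invariant is killed by both and then by their commutator, which fixes
its weight.

Decomposition: a highest weight vector `v` with `e = dg - 2q` spans, with its lowered images, a copy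
of `S^e ℂ²` (`stringMap_equivariant`). The sum of all these maps is injective, because `opD` reduces
a relation to one among highest weight vectors of distinct weights. It is onto degree `g`: lowered
highest weight vectors fill the weights `p ≤ dg/2`, and the Weyl element reflects these to the
others. -/

noncomputable section

namespace CayleySylvester

/-! ### Counting monomials by weight: Gaussian binomials. -/

section Counting

open PowerSeries in
/-- The generating function of the exponents of degree `g` in `d + 1` variables, by weight. -/
def gaussSeries (g d : ℕ) : PowerSeries ℚ :=
  ∑ ν ∈ Finset.piAntidiag (Finset.univ : Finset (Fin (d + 1))) g,
    (X : PowerSeries ℚ) ^ (∑ i : Fin (d + 1), (i : ℕ) * ν i)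

theorem gaussSeries_degree_zero (d : ℕ) : gaussSeries 0 d = 1 := by
  simp [gaussSeries]

theorem gaussSeries_order_zero (g : ℕ) : gaussSeries g 0 = 1 := by
  have h : Finset.piAntidiag (Finset.univ : Finset (Fin (0 + 1))) g = {fun _ => g} := by
    ext f
    simp [funext_iff, Fin.forall_fin_one]
  rw [gaussSeries, h]
  simp

/-- Pascal's rule for Gaussian binomials: either the last variable does not occur, or one factor of
it is removed, which lowers the degree by one and the weight by `d + 1`. -/
theorem gaussSeries_succ_succ (g d : ℕ) :
    gaussSeries (g + 1) (d + 1) =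
      gaussSeries (g + 1) d + PowerSeries.X ^ (d + 1) * gaussSeries g (d + 1) := by
  rw [gaussSeries, ← Finset.sum_filter_add_sum_filter_not _ (fun ν => ν (Fin.last (d + 1)) = 0)]
  congr 1
  · refine Finset.sum_bij' (fun ν _ => Fin.init ν) (fun ν _ => Fin.snoc (α := fun _ => ℕ) ν 0)
      ?_ ?_ ?_ ?_ ?_
    · intro ν hν
      simp only [Finset.mem_filter, Finset.mem_piAntidiag, Finset.mem_univ, implies_true,
        and_true, Fin.sum_univ_castSucc (n := d + 1)] at hν ⊢
      rw [hν.2, add_zero] at hν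
      exact hν.1
    · intro ν hν
      simp only [Finset.mem_filter, Finset.mem_piAntidiag, Finset.mem_univ, implies_true,
        and_true, Fin.sum_univ_castSucc (n := d + 1), Fin.snoc_castSucc, Fin.snoc_last,
        add_zero] at hν ⊢
      exact hν
    · intro ν hν
      rw [Finset.mem_filter] at hν
      rw [← hν.2]
      exact Fin.snoc_init_self (α := fun _ => ℕ) ν
    · intro ν _
      exact Fin.init_snoc (α := fun _ => ℕ) _ _
    · intro ν hν
      rw [Finset.mem_filter] at hν
      rw [Fin.sum_univ_castSucc (n := d + 1), hν.2]
      simp [Fin.init]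
  · rw [gaussSeries, Finset.mul_sum]
    have hsum : ∀ ν : Fin (d + 2) → ℕ,
        ∑ i, (ν + Pi.single (Fin.last (d + 1)) 1 : Fin (d + 2) → ℕ) i = ∑ i, ν i + 1 := by
      intro ν
      simp [Finset.sum_add_distrib]
    have hinv : ∀ ν : Fin (d + 2) → ℕ, ν (Fin.last (d + 1)) ≠ 0 →
        ν - Pi.single (Fin.last (d + 1)) 1 + Pi.single (Fin.last (d + 1)) 1 = ν := by
      intro ν hν
      funext i
      by_cases hi : i = Fin.last (d + 1)
      · subst hi
        simp
        lia
      · simp [hi]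
    refine Finset.sum_bij' (fun ν _ => ν - Pi.single (Fin.last (d + 1)) 1)
      (fun ν _ => ν + Pi.single (Fin.last (d + 1)) 1) ?_ ?_ ?_ ?_ ?_
    · intro ν hν
      simp only [Finset.mem_filter, Finset.mem_piAntidiag, Finset.mem_univ, implies_true,
        and_true] at hν ⊢
      have h := hsum (ν - Pi.single (Fin.last (d + 1)) 1)
      rw [hinv ν hν.2, hν.1] at h
      exact (Nat.add_right_cancel h).symm
    · intro ν hν
      simp only [Finset.mem_filter, Finset.mem_piAntidiag, Finset.mem_univ, implies_true,
        and_true] at hν ⊢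
      rw [hsum, hν]
      simp
    · intro ν hν
      exact hinv ν (Finset.mem_filter.mp hν).2
    · intro ν _
      exact add_tsub_cancel_right _ _
    · intro ν hν
      rw [← pow_add]
      congr 1
      conv_lhs => rw [← hinv ν (Finset.mem_filter.mp hν).2]
      simp only [Pi.add_apply, mul_add, Finset.sum_add_distrib, Pi.single_apply]
      simp
      ring

theorem gaussSeries_mul (g d : ℕ) :
    gaussSeries g d * ∏ i ∈ Finset.Icc 1 g, (1 - PowerSeries.X ^ i) =
      ∏ i ∈ Finset.Icc 1 g, (1 - PowerSeries.X ^ (d + i)) := by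
  induction g generalizing d with
  | zero => simp [gaussSeries_degree_zero]
  | succ g ih =>
    induction d with
    | zero => simp [gaussSeries_order_zero]
    | succ d ihd =>
      have hshift : ∏ i ∈ Finset.Icc 1 (g + 1), ((1 : PowerSeries ℚ) - PowerSeries.X ^ (d + i)) =
          (1 - PowerSeries.X ^ (d + 1)) *
            ∏ i ∈ Finset.Icc 1 g, (1 - PowerSeries.X ^ (d + 1 + i)) := by
        simp only [← Finset.Ico_add_one_right_eq_Icc]
        rw [Finset.prod_eq_prod_Ico_succ_bot (by lia), Finset.prod_Ico_add' _ 1 (g + 1) 1 |>.symm]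
        congr 1
        refine Finset.prod_congr rfl fun i _ => ?_
        rw [add_assoc, add_comm i 1]
      have ih' := ih (d + 1)
      rw [gaussSeries_succ_succ, add_mul, ihd, hshift,
        Finset.prod_Icc_succ_top (by lia), Finset.prod_Icc_succ_top (by lia), ← ih']
      ring

/-- The denominator of `csSeries` omits the factor with `i = 1`. For `g = 0` there is no such factor
to omit and the identity fails; `coeff_csSeries` recovers that case, where only the constant
coefficient matters. -/
theorem csSeries_eq {g : ℕ} (hg : 0 < g) (d : ℕ) :
    csSeries g d = (1 - PowerSeries.X) * gaussSeries g d := by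
  have hc : PowerSeries.constantCoeff
      (∏ i ∈ Finset.Icc 2 g, ((1 : PowerSeries ℚ) - PowerSeries.X ^ i)) ≠ 0 := by
    rw [map_prod, Finset.prod_ne_zero_iff]
    intro i hi
    have : i ≠ 0 := by
      have := (Finset.mem_Icc.mp hi).1
      lia
    simp [this]
  rw [csSeries, ← gaussSeries_mul, eq_comm, PowerSeries.eq_mul_inv_iff_mul_eq hc]
  rw [← Finset.Ico_add_one_right_eq_Icc 1 g, Finset.prod_eq_prod_Ico_succ_bot (by lia),
    Finset.Ico_add_one_right_eq_Icc]
  ring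

theorem weightSpace_eq_restrictSupport (g p d : ℕ) :
    weightSpace g p d = MvPolynomial.restrictSupport ℂ
      {ν : Fin (d + 1) →₀ ℕ | ∑ i, ν i = g ∧ ∑ i : Fin (d + 1), (i : ℕ) * ν i = p} := by
  ext x
  rw [MvPolynomial.mem_restrictSupport_iff]
  simp only [weightSpace, Submodule.mem_inf, MvPolynomial.mem_homogeneousSubmodule,
    MvPolynomial.mem_weightedHomogeneousSubmodule, MvPolynomial.IsHomogeneous,
    MvPolynomial.IsWeightedHomogeneous, Set.subset_def, Finset.mem_coe, MvPolynomial.mem_support_iff,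
    Set.mem_ofPred_eq, Finsupp.weight_apply, ← forall_and]
  simp [Finsupp.sum_fintype, mul_comm]

theorem finite_isobaric (g p d : ℕ) :
    {ν : Fin (d + 1) →₀ ℕ | ∑ i, ν i = g ∧ ∑ i : Fin (d + 1), (i : ℕ) * ν i = p}.Finite := by
  refine Set.Finite.subset ((Finset.finsuppAntidiag Finset.univ g).finite_toSet) fun ν hν => ?_
  simpa using hν.1

instance finite_weightSpace (g p d : ℕ) : Module.Finite ℂ (weightSpace g p d) := by
  rw [weightSpace_eq_restrictSupport]
  have := (finite_isobaric g p d).to_subtype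
  exact Module.Finite.of_basis (MvPolynomial.basisRestrictSupport ℂ _)

theorem finrank_weightSpace (g p d : ℕ) :
    (Module.finrank ℂ (weightSpace g p d) : ℚ) = PowerSeries.coeff p (gaussSeries g d) := by
  have hs : Module.finrank ℂ (weightSpace g p d) =
      ((Finset.piAntidiag (Finset.univ : Finset (Fin (d + 1))) g).filter
        fun ν => p = ∑ i : Fin (d + 1), (i : ℕ) * ν i).card := by
    rw [weightSpace_eq_restrictSupport,
      Module.finrank_eq_nat_card_basis (MvPolynomial.basisRestrictSupport ℂ _)]
    rw [← Nat.card_eq_finsetCard]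
    refine Nat.card_congr (Finsupp.equivFunOnFinite.subtypeEquiv fun ν => ?_)
    simp [eq_comm]
  rw [hs, gaussSeries, map_sum]
  simp [PowerSeries.coeff_X_pow]

theorem coeff_csSeries {g p d : ℕ} (h : 2 * p ≤ d * g) :
    PowerSeries.coeff p (csSeries g d) =
      PowerSeries.coeff p ((1 - PowerSeries.X) * gaussSeries g d) := by
  rcases Nat.eq_zero_or_pos g with rfl | hg
  · obtain rfl : p = 0 := by lia
    simp [csSeries, gaussSeries_degree_zero]
  · rw [csSeries_eq hg]

end Counting

/-! ### The sl(2) action by derivations, and highest weight theory. -/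

section Operators

open MvPolynomial

/-- The coefficient `a_n`, with `a_n = 0` for `n > d`. -/
def coeffVar (d n : ℕ) : MvPolynomial (Fin (d + 1)) ℂ :=
  if h : n < d + 1 then X ⟨n, h⟩ else 0

theorem coeffVar_of_lt {d n : ℕ} (h : n < d + 1) : coeffVar d n = X ⟨n, h⟩ := dif_pos h

theorem coeffVar_of_le {d n : ℕ} (h : d < n) : coeffVar d n = 0 := dif_neg (by lia)

@[simp]
theorem coeffVar_val {d : ℕ} (i : Fin (d + 1)) : coeffVar d i = X i := coeffVar_of_lt i.2

/-- At `n = 0` the truncated index `n - 1` is harmless because the scalar vanishes. The bound on `n`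
matters: at `n = d + 1` the left side is `0` and the right side is not. -/
theorem opD_coeffVar {d n : ℕ} (h : n ≤ d) :
    opD d (coeffVar d n) = (n : ℂ) • coeffVar d (n - 1) := by
  have hsum : ∀ x, opD d x = ∑ i : Fin d, (C (((i : ℕ) : ℂ) + 1) * X i.castSucc) *
      pderiv i.succ x := by
    intro x
    rw [opD, ← Derivation.coeFnAddMonoidHom_apply, map_sum, Finset.sum_apply]
    rfl
  rw [hsum, coeffVar_of_lt (by lia)]
  cases n with
  | zero =>
    simp only [Nat.cast_zero, zero_smul]
    refine Finset.sum_eq_zero fun i _ => ?_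
    rw [pderiv_X_of_ne, mul_zero]
    exact (Fin.succ_ne_zero i).symm
  | succ n =>
    rw [Finset.sum_eq_single ⟨n, by lia⟩]
    · have : (⟨n + 1, by lia⟩ : Fin (d + 1)) = Fin.succ ⟨n, by lia⟩ := rfl
      rw [this, pderiv_X_self, mul_one, coeffVar_of_lt (by lia), smul_eq_C_mul]
      simp
    · intro i _ hi
      rw [pderiv_X_of_ne, mul_zero]
      intro h
      apply hi
      ext
      simpa using (congrArg Fin.val h).symm
    · simp

/-- The lowering operator `∑ (d - i) aᵢ₊₁ ∂/∂aᵢ`. -/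
def opF (d : ℕ) : Derivation ℂ (MvPolynomial (Fin (d + 1)) ℂ) (MvPolynomial (Fin (d + 1)) ℂ) :=
  mkDerivation ℂ fun i => ((d : ℂ) - (i : ℕ)) • coeffVar d (i + 1)

theorem opF_coeffVar (d n : ℕ) :
    opF d (coeffVar d n) = ((d : ℂ) - n) • coeffVar d (n + 1) := by
  rcases Nat.lt_or_ge n (d + 1) with h | h
  · rw [coeffVar_of_lt h, opF, mkDerivation_X]
  · rw [coeffVar_of_le h, coeffVar_of_le (by lia), map_zero, smul_zero]

/-- The derivation multiplying the variable `i` by `c i`. -/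
def scaleDerivation {σ : Type*} (c : σ → ℂ) : Derivation ℂ (MvPolynomial σ ℂ) (MvPolynomial σ ℂ) :=
  mkDerivation ℂ fun i => c i • X i

@[simp]
theorem scaleDerivation_X {σ : Type*} (c : σ → ℂ) (i : σ) :
    scaleDerivation c (X i) = c i • X i := mkDerivation_X _ _ _

theorem scaleDerivation_monomial {σ : Type*} [Fintype σ] (c : σ → ℂ) (ν : σ →₀ ℕ) (r : ℂ) :
    scaleDerivation c (monomial ν r) = (∑ i, c i * ν i) • monomial ν r := by
  classical
  rw [scaleDerivation, mkDerivation_monomial, Finsupp.sum_fintype _ _ (by simp), Finset.sum_smul,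
    Finset.smul_sum]
  refine Finset.sum_congr rfl fun i _ => ?_
  by_cases hi : ν i = 0
  · simp [hi]
  · have h : ν - Finsupp.single i 1 + Finsupp.single i 1 = ν :=
      tsub_add_cancel_of_le (by simpa [Nat.one_le_iff_ne_zero] using hi)
    rw [smul_eq_mul, mul_smul_comm, X, monomial_mul, h, smul_monomial, smul_monomial,
      smul_monomial]
    congr 1
    simp only [smul_eq_mul]
    ring

theorem coeff_scaleDerivation {σ : Type*} [Fintype σ] (c : σ → ℂ) (x : MvPolynomial σ ℂ)
    (ν : σ →₀ ℕ) : coeff ν (scaleDerivation c x) = (∑ i, c i * ν i) * coeff ν x := by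
  classical
  induction x using MvPolynomial.induction_on' with
  | monomial μ r =>
    rw [scaleDerivation_monomial, coeff_smul, coeff_monomial]
    split_ifs with h
    · rw [h, smul_eq_mul]
    · simp
  | add x y hx hy => rw [map_add, coeff_add, coeff_add, hx, hy, mul_add]

/-- Monomials diagonalize a scaling derivation. Degree and weight thereby become eigenvalue
equations, to which the commutation relations apply. -/
theorem mem_eigenspace_iff {σ : Type*} [Fintype σ] (c : σ → ℂ) (r : ℂ) (x : MvPolynomial σ ℂ) :
    scaleDerivation c x = r • x ↔ ∀ ν, coeff ν x ≠ 0 → ∑ i, c i * ν i = r := by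
  rw [MvPolynomial.ext_iff]
  refine forall_congr' fun ν => ?_
  rw [coeff_scaleDerivation, coeff_smul, smul_eq_mul, mul_eq_mul_right_iff]
  tauto

/-- The Euler derivation, acting on forms of degree `g` as multiplication by `g`. -/
abbrev opN (d : ℕ) : Derivation ℂ (MvPolynomial (Fin (d + 1)) ℂ) (MvPolynomial (Fin (d + 1)) ℂ) :=
  scaleDerivation fun _ => 1

/-- The derivation acting on isobaric polynomials of weight `p` as multiplication by `p`. -/
abbrev opW (d : ℕ) : Derivation ℂ (MvPolynomial (Fin (d + 1)) ℂ) (MvPolynomial (Fin (d + 1)) ℂ) :=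
  scaleDerivation fun i => ((i : ℕ) : ℂ)

theorem mem_homogeneousSubmodule_iff_opN {g d : ℕ} {x : MvPolynomial (Fin (d + 1)) ℂ} :
    x ∈ homogeneousSubmodule (Fin (d + 1)) ℂ g ↔ opN d x = (g : ℂ) • x := by
  rw [mem_eigenspace_iff, mem_homogeneousSubmodule, IsHomogeneous, IsWeightedHomogeneous]
  refine forall_congr' fun ν => imp_congr_right fun _ => ?_
  rw [← Nat.cast_inj (R := ℂ), Finsupp.weight_apply, Finsupp.sum_fintype _ _ (by simp)]
  simp

theorem mem_weightSpace {g p d : ℕ} {x : MvPolynomial (Fin (d + 1)) ℂ} :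
    x ∈ weightSpace g p d ↔ opN d x = (g : ℂ) • x ∧ opW d x = (p : ℂ) • x := by
  rw [weightSpace, Submodule.mem_inf, mem_homogeneousSubmodule_iff_opN, mem_eigenspace_iff _ (p : ℂ),
    mem_weightedHomogeneousSubmodule, IsWeightedHomogeneous]
  refine and_congr_right fun _ => forall_congr' fun ν => imp_congr_right fun _ => ?_
  rw [← Nat.cast_inj (R := ℂ), Finsupp.weight_apply, Finsupp.sum_fintype _ _ (by simp)]
  simp [mul_comm]

theorem opN_coeffVar (d n : ℕ) : opN d (coeffVar d n) = coeffVar d n := by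
  unfold coeffVar
  split_ifs <;> simp

theorem opW_coeffVar (d n : ℕ) : opW d (coeffVar d n) = (n : ℂ) • coeffVar d n := by
  unfold coeffVar
  split_ifs <;> simp

theorem derivation_ext_coeffVar {d : ℕ}
    {D D' : Derivation ℂ (MvPolynomial (Fin (d + 1)) ℂ) (MvPolynomial (Fin (d + 1)) ℂ)}
    (h : ∀ n ≤ d, D (coeffVar d n) = D' (coeffVar d n)) : D = D' := by
  refine derivation_ext fun i => ?_
  rw [← coeffVar_val]
  exact h i (Nat.lt_succ_iff.mp i.2)

theorem lie_opN_opD (d : ℕ) : ⁅opN d, opD d⁆ = 0 := by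
  refine derivation_ext_coeffVar fun n hn => ?_
  simp [Derivation.commutator_apply, opD_coeffVar hn, opN_coeffVar]

theorem lie_opN_opF (d : ℕ) : ⁅opN d, opF d⁆ = 0 := by
  refine derivation_ext_coeffVar fun n hn => ?_
  simp [Derivation.commutator_apply, opF_coeffVar, opN_coeffVar]

theorem lie_opW_opD (d : ℕ) : ⁅opW d, opD d⁆ = -opD d := by
  refine derivation_ext_coeffVar fun n hn => ?_
  cases n with
  | zero => simp [Derivation.commutator_apply, opD_coeffVar hn, opW_coeffVar]
  | succ n =>
    simp only [Derivation.commutator_apply, opD_coeffVar hn, opW_coeffVar, Derivation.map_smul,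
      Derivation.neg_apply, Nat.add_sub_cancel]
    push_cast
    module

theorem lie_opW_opF (d : ℕ) : ⁅opW d, opF d⁆ = opF d := by
  refine derivation_ext_coeffVar fun n hn => ?_
  simp only [Derivation.commutator_apply, opF_coeffVar, opW_coeffVar, Derivation.map_smul]
  push_cast
  module

theorem lie_opD_opF (d : ℕ) : ⁅opD d, opF d⁆ = (d : ℂ) • opN d - (2 : ℂ) • opW d := by
  refine derivation_ext_coeffVar fun n hn => ?_
  have h1 : opD d (opF d (coeffVar d n)) = (((d : ℂ) - n) * (n + 1)) • coeffVar d n := by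
    rw [opF_coeffVar, Derivation.map_smul]
    rcases hn.eq_or_lt with rfl | hlt
    · simp
    · rw [opD_coeffVar hlt, Nat.succ_sub_one, smul_smul]
      push_cast
      rfl
  have h2 : opF d (opD d (coeffVar d n)) = ((n : ℂ) * (d - n + 1)) • coeffVar d n := by
    rw [opD_coeffVar hn, Derivation.map_smul]
    cases n with
    | zero => simp
    | succ n =>
      rw [opF_coeffVar, Nat.add_sub_cancel, smul_smul]
      push_cast
      congr 1
      ring
  rw [Derivation.commutator_apply, h1, h2, Derivation.sub_apply, Derivation.smul_apply,
    Derivation.smul_apply, opN_coeffVar, opW_coeffVar]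
  module

variable {g p d : ℕ}

theorem opN_opD (x : MvPolynomial (Fin (d + 1)) ℂ) : opN d (opD d x) = opD d (opN d x) := by
  have h := congrArg (· x) (lie_opN_opD d)
  simpa [Derivation.commutator_apply, sub_eq_zero] using h

theorem opN_opF (x : MvPolynomial (Fin (d + 1)) ℂ) : opN d (opF d x) = opF d (opN d x) := by
  have h := congrArg (· x) (lie_opN_opF d)
  simpa [Derivation.commutator_apply, sub_eq_zero] using h

theorem opW_opD (x : MvPolynomial (Fin (d + 1)) ℂ) :
    opW d (opD d x) = opD d (opW d x) - opD d x := by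
  have h := congrArg (· x) (lie_opW_opD d)
  simp only [Derivation.commutator_apply, Derivation.neg_apply] at h
  rw [sub_eq_iff_eq_add.mp h]
  abel

theorem opW_opF (x : MvPolynomial (Fin (d + 1)) ℂ) :
    opW d (opF d x) = opF d (opW d x) + opF d x := by
  have h := congrArg (· x) (lie_opW_opF d)
  simp only [Derivation.commutator_apply] at h
  rw [sub_eq_iff_eq_add.mp h]
  abel

theorem opD_opF (x : MvPolynomial (Fin (d + 1)) ℂ) :
    opD d (opF d x) = opF d (opD d x) + ((d : ℂ) • opN d x - (2 : ℂ) • opW d x) := by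
  have h := congrArg (· x) (lie_opD_opF d)
  simp only [Derivation.commutator_apply, Derivation.sub_apply, Derivation.smul_apply] at h
  rw [sub_eq_iff_eq_add.mp h]
  abel

theorem opD_mem {x : MvPolynomial (Fin (d + 1)) ℂ} (hx : x ∈ weightSpace g (p + 1) d) :
    opD d x ∈ weightSpace g p d := by
  rw [mem_weightSpace] at hx ⊢
  rw [opN_opD, opW_opD, hx.1, hx.2, Derivation.map_smul, Derivation.map_smul]
  refine ⟨rfl, ?_⟩
  push_cast
  module

theorem opF_mem {x : MvPolynomial (Fin (d + 1)) ℂ} (hx : x ∈ weightSpace g p d) :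
    opF d x ∈ weightSpace g (p + 1) d := by
  rw [mem_weightSpace] at hx ⊢
  rw [opN_opF, opW_opF, hx.1, hx.2, Derivation.map_smul, Derivation.map_smul]
  refine ⟨rfl, ?_⟩
  push_cast
  module

theorem opF_iterate_mem {x : MvPolynomial (Fin (d + 1)) ℂ} (hx : x ∈ weightSpace g p d) (k : ℕ) :
    (opF d)^[k] x ∈ weightSpace g (p + k) d := by
  induction k with
  | zero => exact hx
  | succ k ih =>
    rw [Function.iterate_succ_apply']
    exact opF_mem ih

/-- The image would have weight `-1`, while the weight of a monomial is a natural number. -/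
theorem opD_eq_zero {x : MvPolynomial (Fin (d + 1)) ℂ} (hx : x ∈ weightSpace g 0 d) :
    opD d x = 0 := by
  rw [mem_weightSpace] at hx
  have h : opW d (opD d x) = (-1 : ℂ) • opD d x := by
    rw [opW_opD, hx.2]
    simp
  rw [mem_eigenspace_iff] at h
  ext ν
  by_contra hν
  have h1 := h ν hν
  have h2 : ((∑ i : Fin (d + 1), (i : ℕ) * ν i + 1 : ℕ) : ℂ) = 0 := by
    push_cast
    rw [h1]
    ring
  exact absurd (Nat.cast_eq_zero.mp h2) (by lia)

theorem opD_iterate_eq_zero {x : MvPolynomial (Fin (d + 1)) ℂ} (hx : x ∈ weightSpace g p d)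
    {k : ℕ} (hk : p < k) : (opD d)^[k] x = 0 := by
  induction p generalizing x k with
  | zero =>
    obtain ⟨k, rfl⟩ : ∃ j, k = j + 1 := ⟨k - 1, by lia⟩
    rw [Function.iterate_succ_apply, opD_eq_zero hx, iterate_map_zero]
  | succ p ih =>
    obtain ⟨k, rfl⟩ : ∃ j, k = j + 1 := ⟨k - 1, by lia⟩
    exact ih (opD_mem hx) (by lia)

theorem opD_iterate_mem {x : MvPolynomial (Fin (d + 1)) ℂ} {k : ℕ}
    (hx : x ∈ weightSpace g (p + k) d) : (opD d)^[k] x ∈ weightSpace g p d := by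
  induction k generalizing x with
  | zero => exact hx
  | succ k ih => exact ih (opD_mem hx)

theorem eq_zero_of_mem_weightSpace {x : MvPolynomial (Fin (d + 1)) ℂ}
    (hx : x ∈ weightSpace g p d) (hp : d * g < p) : x = 0 := by
  rw [weightSpace_eq_restrictSupport, mem_restrictSupport_iff] at hx
  rw [← support_eq_empty, Finset.eq_empty_iff_forall_notMem]
  intro ν hν
  obtain ⟨h1, h2⟩ := hx hν
  have : ∑ i : Fin (d + 1), (i : ℕ) * ν i ≤ ∑ i : Fin (d + 1), d * ν i :=
    Finset.sum_le_sum fun i _ => Nat.mul_le_mul_right _ (Nat.lt_succ_iff.mp i.2)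
  rw [← Finset.mul_sum, h1, h2] at this
  lia

theorem opD_opF_of_mem {x : MvPolynomial (Fin (d + 1)) ℂ} (hx : x ∈ weightSpace g p d) :
    opD d (opF d x) = opF d (opD d x) + ((d : ℂ) * g - 2 * p) • x := by
  rw [mem_weightSpace] at hx
  rw [opD_opF, hx.1, hx.2]
  module

/-- Moving `opD` past the lowering operators one at a time adds up the scalars `dg - 2(p + j)` for
`0 ≤ j ≤ k`. -/
theorem opD_opF_iterate {u : MvPolynomial (Fin (d + 1)) ℂ} (hu : u ∈ kerD g p d) (k : ℕ) :
    opD d ((opF d)^[k + 1] u) =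
      (((k : ℂ) + 1) * ((d : ℂ) * g - 2 * p - k)) • (opF d)^[k] u := by
  induction k with
  | zero =>
    have h0 : opD d u = 0 := hu.2
    simp [opD_opF_of_mem hu.1, h0]
  | succ k ih =>
    rw [Function.iterate_succ_apply', opD_opF_of_mem (opF_iterate_mem hu.1 _), ih, Derivation.map_smul,
      ← Function.iterate_succ_apply' (opF d)]
    push_cast
    module

/-- Descending induction on `k`, starting beyond the largest weight `dg`: if `F^(k+1) u = 0`,
applying `opD` gives `(k + 1)(e - k) F^k u = 0`, and the scalar is nonzero for `k > e`. -/
theorem opF_iterate_eq_zero {u : MvPolynomial (Fin (d + 1)) ℂ} (hu : u ∈ kerD g p d) {e k : ℕ}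
    (he : 2 * p + e = d * g) (hk : e < k) : (opF d)^[k] u = 0 := by
  by_cases hk' : d * g < k
  · exact eq_zero_of_mem_weightSpace (opF_iterate_mem hu.1 k) (by lia)
  · induction hn : d * g + 1 - k generalizing k with
    | zero => lia
    | succ n ih =>
      have h := opD_opF_iterate hu k
      have h0 : (opF d)^[k + 1] u = 0 := by
        by_cases hk'' : d * g < k + 1
        · exact eq_zero_of_mem_weightSpace (opF_iterate_mem hu.1 _) (by lia)
        · exact ih (by lia) hk'' (by lia)
      rw [h0, map_zero, eq_comm, smul_eq_zero] at h
      refine h.resolve_left (mul_ne_zero (by exact_mod_cast Nat.succ_ne_zero k) ?_)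
      have he' : (2 : ℂ) * p + e = d * g := by exact_mod_cast he
      rw [← he', show (2 : ℂ) * p + e - 2 * p - k = e - k by ring, sub_ne_zero]
      exact_mod_cast hk.ne

theorem exists_opD_iterate_opF_iterate {u : MvPolynomial (Fin (d + 1)) ℂ} (hu : u ∈ kerD g p d)
    {k : ℕ} (hk : 2 * p + k ≤ d * g) :
    ∃ c : ℂ, c ≠ 0 ∧ (opD d)^[k] ((opF d)^[k] u) = c • u := by
  induction k with
  | zero => exact ⟨1, one_ne_zero, by simp⟩
  | succ k ih =>
    obtain ⟨c, hc, h⟩ := ih (by lia)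
    have hk' : ((k : ℂ) + 1) * ((d : ℂ) * g - 2 * p - k) ≠ 0 := by
      refine mul_ne_zero (by exact_mod_cast Nat.succ_ne_zero k) ?_
      obtain ⟨m, hm⟩ := Nat.exists_eq_add_of_le hk
      have hm' : (d : ℂ) * g = 2 * p + (k + 1) + m := by exact_mod_cast hm
      rw [hm', show (2 : ℂ) * p + (k + 1) + m - 2 * p - k = ((m + 1 : ℕ) : ℂ) by push_cast; ring]
      exact Nat.cast_ne_zero.mpr (Nat.succ_ne_zero m)
    refine ⟨_, mul_ne_zero hk' hc, ?_⟩
    rw [Function.iterate_succ_apply (opD d), opD_opF_iterate hu, ← Derivation.coeFn_coe,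
      ← Module.End.pow_apply, map_smul, Module.End.pow_apply, Derivation.coeFn_coe, h, smul_smul]

/-- Every vector of nonnegative `SL(2)`-weight is a sum of lowered highest weight vectors. -/
theorem weightSpace_le_of_lowered_mem (h : 2 * p ≤ d * g)
    (N : Submodule ℂ (MvPolynomial (Fin (d + 1)) ℂ))
    (hN : ∀ q k, q + k = p → ∀ u ∈ kerD g q d, (opF d)^[k] u ∈ N) :
    weightSpace g p d ≤ N := by
  -- Induction on the order of nilpotency of `opD` at `x`, which is at most `p + 1`.
  suffices H : ∀ k, ∀ x ∈ weightSpace g p d, (opD d)^[k] x = 0 → x ∈ N from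
    fun x hx => H (p + 1) x hx (opD_iterate_eq_zero hx (by lia))
  intro k
  induction k with
  | zero =>
    rintro x - (rfl : x = 0)
    exact N.zero_mem
  | succ k ih =>
    intro x hx hk
    by_cases hkp : p < k
    · exact ih x hx (opD_iterate_eq_zero hx hkp)
    obtain ⟨q, rfl⟩ : ∃ q, p = q + k := ⟨p - k, by lia⟩
    have hu : (opD d)^[k] x ∈ kerD g q d := by
      refine ⟨opD_iterate_mem hx, ?_⟩
      rw [Function.iterate_succ_apply'] at hk
      exact hk
    obtain ⟨c, hc, hcu⟩ := exists_opD_iterate_opF_iterate (k := k) hu (by lia)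
    have hmem := hN q k rfl _ hu
    -- The last nonzero image `D^k x` is a highest weight vector. Lowering it back and rescaling
    -- gives a correction after which `D^k` already kills the difference.
    have hx' : x = (x - c⁻¹ • (opF d)^[k] ((opD d)^[k] x)) + c⁻¹ • (opF d)^[k] ((opD d)^[k] x) := by
      abel
    rw [hx']
    refine N.add_mem (ih _ ?_ ?_) (N.smul_mem _ hmem)
    · exact Submodule.sub_mem _ hx (Submodule.smul_mem _ _ (opF_iterate_mem hu.1 k))
    · rw [iterate_map_sub]
      conv_lhs => rw [← Derivation.coeFn_coe (opD d), ← Module.End.pow_apply,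
        ← Module.End.pow_apply, map_smul, Module.End.pow_apply, Module.End.pow_apply,
        Derivation.coeFn_coe (opD d)]
      rw [hcu, smul_smul, inv_mul_cancel₀ hc, one_smul, sub_self]

/-- Weight `p` is spanned by vectors `F^k u` with `u` of highest weight, and each is a multiple of
`D F^(k+1) u`; the factor is nonzero as long as weight `p + 1` does not pass the middle. -/
theorem map_opD_weightSpace (h : 2 * (p + 1) ≤ d * g) :
    (weightSpace g (p + 1) d).map (opD d).toLinearMap = weightSpace g p d := by
  refine le_antisymm ?_ (weightSpace_le_of_lowered_mem (by lia) _ ?_)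
  · rintro _ ⟨x, hx, rfl⟩
    exact opD_mem hx
  · intro q k hqk u hu
    have hc : ((k : ℂ) + 1) * ((d : ℂ) * g - 2 * q - k) ≠ 0 := by
      refine mul_ne_zero (by exact_mod_cast Nat.succ_ne_zero k) ?_
      obtain ⟨m, hm⟩ := Nat.exists_eq_add_of_le h
      have hm' : (d : ℂ) * g = 2 * (q + k + 1) + m := by
        rw [← hqk] at hm
        exact_mod_cast hm
      rw [hm', show (2 : ℂ) * (q + k + 1) + m - 2 * q - k = ((m + k + 2 : ℕ) : ℂ) by
        push_cast; ring]
      exact Nat.cast_ne_zero.mpr (by lia)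
    refine ⟨(((k : ℂ) + 1) * ((d : ℂ) * g - 2 * q - k))⁻¹ • (opF d)^[k + 1] u, ?_, ?_⟩
    · rw [← hqk]
      exact Submodule.smul_mem _ _ (opF_iterate_mem hu.1 (k + 1))
    · rw [map_smul, Derivation.coeFn_coe, opD_opF_iterate hu, smul_smul, inv_mul_cancel₀ hc,
        one_smul]

theorem kerD_zero (g d : ℕ) : kerD g 0 d = weightSpace g 0 d := by
  rw [kerD, inf_eq_left]
  exact fun x hx => opD_eq_zero hx

theorem finrank_kerD_add (h : 2 * (p + 1) ≤ d * g) :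
    Module.finrank ℂ (kerD g (p + 1) d) + Module.finrank ℂ (weightSpace g p d) =
      Module.finrank ℂ (weightSpace g (p + 1) d) := by
  have hr := ((opD d).toLinearMap.domRestrict (weightSpace g (p + 1) d)).finrank_range_add_finrank_ker
  rw [LinearMap.range_domRestrict, map_opD_weightSpace h, LinearMap.ker_domRestrict] at hr
  rw [← hr, add_comm, kerD, ← Submodule.map_comap_subtype]
  congr 1
  exact LinearEquiv.finrank_eq (Submodule.equivMapOfInjective _ (Submodule.subtype_injective _) _).symm

/-- Rank-nullity for the surjection `opD` gives a difference of consecutive coefficients of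
`gaussSeries`, which is what the factor `1 - X` produces. -/
theorem finrank_kerD (h : 2 * p ≤ d * g) :
    (Module.finrank ℂ (kerD g p d) : ℚ) = PowerSeries.coeff p (csSeries g d) := by
  rw [coeff_csSeries h, sub_mul, one_mul, map_sub, ← finrank_weightSpace]
  cases p with
  | zero => rw [kerD_zero, PowerSeries.coeff_zero_X_mul, sub_zero]
  | succ p =>
    rw [PowerSeries.coeff_succ_X_mul, ← finrank_weightSpace, ← finrank_kerD_add h]
    push_cast
    ring

end Operators

/-! ### Unipotent substitutions as exponentials, and the Weyl element. -/

section Unipotent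

open MvPolynomial

/-- The substitution `aᵢ ↦ ∑ⱼ (i choose j) T^j aᵢ₋ⱼ` with an indeterminate `T`. -/
def flow (d : ℕ) : MvPolynomial (Fin (d + 1)) ℂ →ₐ[ℂ] Polynomial (MvPolynomial (Fin (d + 1)) ℂ) :=
  aeval fun i => ∑ j ∈ Finset.range (i + 1),
    Polynomial.monomial j (((i : ℕ).choose j : ℂ) • coeffVar d (i - j))

theorem flow_coeffVar {d n : ℕ} (h : n ≤ d) : flow d (coeffVar d n) =
    ∑ j ∈ Finset.range (n + 1), Polynomial.monomial j ((n.choose j : ℂ) • coeffVar d (n - j)) := by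
  rw [coeffVar_of_lt (by lia), flow, aeval_X]

theorem derivative_flow_coeffVar {d n : ℕ} (h : n ≤ d) :
    Polynomial.derivative (flow d (coeffVar d n)) = flow d (opD d (coeffVar d n)) := by
  rw [opD_coeffVar h, map_smul, flow_coeffVar h]
  cases n with
  | zero => simp
  | succ n =>
    rw [Nat.add_sub_cancel, flow_coeffVar (by lia), Finset.sum_range_succ', map_add, map_sum,
      Finset.smul_sum]
    simp only [Polynomial.monomial_zero_left, Polynomial.derivative_C, add_zero]
    refine Finset.sum_congr rfl fun j _ => ?_
    rw [Polynomial.derivative_monomial, Nat.add_sub_cancel, Nat.add_sub_add_right,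
      Polynomial.smul_monomial]
    congr 1
    have h1 : (((n + 1).choose (j + 1) : ℕ) : ℂ) * ((j + 1 : ℕ) : ℂ) =
        ((n + 1 : ℕ) : ℂ) * (n.choose j : ℂ) := by
      exact_mod_cast (Nat.add_one_mul_choose_eq n j).symm
    rw [smul_smul, ← h1, mul_comm, smul_eq_C_mul, smul_eq_C_mul]
    simp only [map_mul, map_natCast]
    push_cast
    ring

/-- The differential equation of `exp(T D)`, for which `T` has to be an indeterminate. Both sides
are derivations along `flow`, so the variables suffice. With the initial value `coeff_zero_flow` it
determines all coefficients. -/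
theorem derivative_flow {d : ℕ} (x : MvPolynomial (Fin (d + 1)) ℂ) :
    Polynomial.derivative (flow d x) = flow d (opD d x) := by
  induction x using MvPolynomial.induction_on with
  | C a =>
    rw [derivation_C, map_zero, ← algebraMap_eq, AlgHom.commutes,
      IsScalarTower.algebraMap_apply ℂ (MvPolynomial (Fin (d + 1)) ℂ), Polynomial.algebraMap_eq,
      Polynomial.derivative_C]
  | add x y hx hy => rw [map_add, map_add, map_add, map_add, hx, hy]
  | mul_X x i hx =>
    have hi := derivative_flow_coeffVar (d := d) (n := i) (by lia)
    rw [coeffVar_val] at hi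
    rw [map_mul, Polynomial.derivative_mul, hx, hi, Derivation.leibniz, map_add, smul_eq_mul,
      smul_eq_mul, map_mul, map_mul]
    ring

theorem coeff_zero_flow {d : ℕ} (x : MvPolynomial (Fin (d + 1)) ℂ) : (flow d x).coeff 0 = x := by
  induction x using MvPolynomial.induction_on with
  | C a =>
    rw [← algebraMap_eq, AlgHom.commutes,
      IsScalarTower.algebraMap_apply ℂ (MvPolynomial (Fin (d + 1)) ℂ), Polynomial.algebraMap_eq,
      Polynomial.coeff_C_zero]
  | add x y hx hy => rw [map_add, Polynomial.coeff_add, hx, hy]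
  | mul_X x i hx =>
    rw [map_mul, Polynomial.mul_coeff_zero, hx, ← coeffVar_val, flow_coeffVar (by lia),
      Polynomial.finsetSum_coeff, Finset.sum_range_succ']
    simp [Polynomial.coeff_monomial]

theorem factorial_smul_coeff_flow {d : ℕ} (n : ℕ) (x : MvPolynomial (Fin (d + 1)) ℂ) :
    (n.factorial : ℂ) • (flow d x).coeff n = (opD d)^[n] x := by
  induction n generalizing x with
  | zero => simp [coeff_zero_flow]
  | succ n ih =>
    rw [Function.iterate_succ_apply, ← ih, ← derivative_flow, Polynomial.coeff_derivative,
      Nat.factorial_succ, mul_comm (n + 1), Nat.cast_mul, mul_smul]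
    congr 1
    rw [smul_eq_C_mul, mul_comm]
    simp

/-- The substitution induced by the unipotent matrix sending `e₁` to `e₁ + t e₀`. -/
def upperAct (d : ℕ) (t : ℂ) : MvPolynomial (Fin (d + 1)) ℂ →ₐ[ℂ] MvPolynomial (Fin (d + 1)) ℂ :=
  aeval fun i => ∑ j ∈ Finset.range (i + 1), (((i : ℕ).choose j : ℂ) * t ^ j) • coeffVar d (i - j)

theorem upperAct_apply {d : ℕ} (t : ℂ) (x : MvPolynomial (Fin (d + 1)) ℂ) :
    upperAct d t x = (flow d x).eval (C t) := by
  have h : upperAct d t = ((Polynomial.aeval (R := MvPolynomial (Fin (d + 1)) ℂ)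
      (C t : MvPolynomial (Fin (d + 1)) ℂ)).restrictScalars ℂ).comp (flow d) := by
    refine algHom_ext fun i => ?_
    rw [AlgHom.comp_apply, ← coeffVar_val, flow_coeffVar (by lia), coeffVar_val, upperAct, aeval_X,
      map_sum]
    refine Finset.sum_congr rfl fun j _ => ?_
    simp [smul_eq_C_mul]
    ring
  rw [h]
  simp

/-- The unipotent substitution is the exponential of the operator `D`. -/
theorem upperAct_of_string {d : ℕ} {y : ℕ → MvPolynomial (Fin (d + 1)) ℂ} {e : ℕ}
    (hy : ∀ i ≤ e, opD d (y i) = (i : ℂ) • y (i - 1)) (t : ℂ) {i : ℕ} (hi : i ≤ e) :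
    upperAct d t (y i) = ∑ j ∈ Finset.range (i + 1), ((i.choose j : ℂ) * t ^ j) • y (i - j) := by
  have hD : ∀ j, (opD d)^[j] (y i) = (i.descFactorial j : ℂ) • y (i - j) := by
    intro j
    induction j with
    | zero => simp
    | succ j ih =>
      rw [Function.iterate_succ_apply', ih, Derivation.map_smul, hy _ (by lia), smul_smul,
        Nat.descFactorial_succ, Nat.sub_sub]
      push_cast
      rw [mul_comm]
  have hc : ∀ j, (flow d (y i)).coeff j = (i.choose j : ℂ) • y (i - j) := by
    intro j
    have h := factorial_smul_coeff_flow j (y i)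
    rw [hD, Nat.descFactorial_eq_factorial_mul_choose, Nat.cast_mul, mul_smul] at h
    exact smul_right_injective _ (Nat.cast_ne_zero.mpr j.factorial_ne_zero) h
  have hdeg : (flow d (y i)).natDegree < i + 1 := by
    rw [Nat.lt_succ_iff, Polynomial.natDegree_le_iff_coeff_eq_zero]
    intro j hj
    rw [hc, Nat.choose_eq_zero_of_lt hj, Nat.cast_zero, zero_smul]
  rw [upperAct_apply, Polynomial.eval_eq_sum_range' hdeg]
  refine Finset.sum_congr rfl fun j _ => ?_
  rw [hc, smul_eq_C_mul, smul_eq_C_mul, map_mul, map_pow]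
  ring

/-- A polynomial in `T` that takes the value `x` at infinitely many constants is constant, and the
linear coefficient of `flow d x` is `D x`. -/
theorem opD_eq_zero_of_upperAct {d : ℕ} {x : MvPolynomial (Fin (d + 1)) ℂ}
    (h : ∀ t, upperAct d t x = x) : opD d x = 0 := by
  have hx : flow d x = Polynomial.C x := by
    refine Polynomial.eq_of_infinite_eval_eq _ _
      ((Set.infinite_range_of_injective (C_injective (Fin (d + 1)) ℂ)).mono ?_)
    rintro _ ⟨t, rfl⟩
    simp [← upperAct_apply, h]
  have h1 := factorial_smul_coeff_flow 1 x
  rw [hx, Polynomial.coeff_C_succ, smul_zero] at h1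
  simpa using h1.symm

theorem upperAct_of_opD_eq_zero {d : ℕ} {x : MvPolynomial (Fin (d + 1)) ℂ}
    (h : opD d x = 0) (t : ℂ) : upperAct d t x = x := by
  simpa using upperAct_of_string (y := fun _ => x) (e := 0) (by simp [h]) t le_rfl

/-- The substitution induced by the matrix sending `e₀` to `e₁` and `e₁` to `-e₀`. -/
def weylAct (d : ℕ) : MvPolynomial (Fin (d + 1)) ℂ →ₐ[ℂ] MvPolynomial (Fin (d + 1)) ℂ :=
  aeval fun i => ((-1 : ℂ) ^ (i : ℕ)) • coeffVar d (d - i)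

theorem weylAct_coeffVar {d n : ℕ} (h : n ≤ d) :
    weylAct d (coeffVar d n) = ((-1 : ℂ) ^ n) • coeffVar d (d - n) := by
  rw [coeffVar_of_lt (by lia), weylAct, aeval_X]

theorem algHom_derivation_comm {σ : Type*} (φ : MvPolynomial σ ℂ →ₐ[ℂ] MvPolynomial σ ℂ)
    (D D' : Derivation ℂ (MvPolynomial σ ℂ) (MvPolynomial σ ℂ))
    (h : ∀ i, φ (D (X i)) = D' (φ (X i))) (x : MvPolynomial σ ℂ) : φ (D x) = D' (φ x) := by
  induction x using MvPolynomial.induction_on with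
  | C a => rw [derivation_C, map_zero, ← algebraMap_eq, AlgHom.commutes, algebraMap_eq, derivation_C]
  | add x y hx hy => simp only [map_add, hx, hy]
  | mul_X x i hx =>
    simp only [Derivation.leibniz, map_add, smul_eq_mul, map_mul, hx, h]

/-- Conjugation by the Weyl element exchanges raising and lowering up to sign, so facts about `opF`
and lower unipotents follow from those about `opD` and upper ones. -/
theorem weylAct_opD {d : ℕ} (x : MvPolynomial (Fin (d + 1)) ℂ) :
    weylAct d (opD d x) = -opF d (weylAct d x) := by
  refine algHom_derivation_comm _ (opD d) (-opF d) (fun i => ?_) x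
  have hi : (i : ℕ) ≤ d := by lia
  rw [← coeffVar_val, opD_coeffVar hi, map_smul, weylAct_coeffVar hi, Derivation.neg_apply,
    Derivation.map_smul, opF_coeffVar, weylAct_coeffVar (by lia), Nat.cast_sub hi]
  rcases Nat.eq_zero_or_pos (i : ℕ) with h | h
  · simp [h]
  · obtain ⟨n, hn⟩ : ∃ n, (i : ℕ) = n + 1 := ⟨i - 1, by lia⟩
    rw [hn, Nat.add_sub_cancel, pow_succ, show d - (n + 1) + 1 = d - n by lia]
    module

theorem weylAct_mem {g p d : ℕ} (hp : p ≤ d * g) {x : MvPolynomial (Fin (d + 1)) ℂ}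
    (hx : x ∈ weightSpace g p d) : weylAct d x ∈ weightSpace g (d * g - p) d := by
  rw [mem_weightSpace] at hx ⊢
  have hN : ∀ x, weylAct d (opN d x) = opN d (weylAct d x) := by
    refine algHom_derivation_comm _ _ _ fun i => ?_
    have hi : (i : ℕ) ≤ d := by lia
    rw [← coeffVar_val, opN_coeffVar, weylAct_coeffVar hi, Derivation.map_smul, opN_coeffVar]
  have hW : ∀ x, weylAct d (opW d x) = ((d : ℂ) • opN d - opW d) (weylAct d x) := by
    refine algHom_derivation_comm _ _ _ fun i => ?_
    have hi : (i : ℕ) ≤ d := by lia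
    rw [← coeffVar_val, opW_coeffVar, map_smul, weylAct_coeffVar hi, Derivation.map_smul,
      Derivation.sub_apply, Derivation.smul_apply, opN_coeffVar, opW_coeffVar, Nat.cast_sub hi]
    module
  have h1 := hN x
  have h2 := hW x
  rw [hx.1, map_smul] at h1
  rw [hx.2, map_smul, Derivation.sub_apply, Derivation.smul_apply, ← h1] at h2
  refine ⟨h1.symm, ?_⟩
  rw [← sub_sub_self ((d : ℂ) • (g : ℂ) • weylAct d x) (opW d (weylAct d x)), ← h2,
    Nat.cast_sub hp]
  push_cast
  module

end Unipotent

/-! ### Generation of `SL(2, ℂ)` by unipotent matrices. -/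

section Generators

/-- The upper unipotent matrix with entry `t`. -/
def upper (t : ℂ) : SL(2, ℂ) := ⟨!![1, t; 0, 1], by simp [Matrix.det_fin_two]⟩

/-- The lower unipotent matrix with entry `t`. -/
def lower (t : ℂ) : SL(2, ℂ) := ⟨!![1, 0; t, 1], by simp [Matrix.det_fin_two]⟩

/-- The rotation sending `e₀` to `e₁` and `e₁` to `-e₀`. -/
def weyl : SL(2, ℂ) := ⟨!![0, -1; 1, 0], by simp [Matrix.det_fin_two]⟩

@[simp]
theorem coe_upper (t : ℂ) : (upper t : Matrix (Fin 2) (Fin 2) ℂ) = !![1, t; 0, 1] := rfl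

@[simp]
theorem coe_lower (t : ℂ) : (lower t : Matrix (Fin 2) (Fin 2) ℂ) = !![1, 0; t, 1] := rfl

@[simp]
theorem coe_weyl : (weyl : Matrix (Fin 2) (Fin 2) ℂ) = !![0, -1; 1, 0] := rfl

theorem lower_eq (t : ℂ) : lower t = weyl * upper (-t) * weyl⁻¹ := by
  rw [eq_mul_inv_iff_mul_eq]
  ext i j
  fin_cases i <;> fin_cases j <;> simp [Matrix.mul_apply]

/-- `SL(2, ℂ)` is generated by unipotent matrices. -/
theorem sl2_induction {P : SL(2, ℂ) → Prop} (hu : ∀ t, P (upper t)) (hl : ∀ t, P (lower t))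
    (hm : ∀ γ δ, P γ → P δ → P (γ * δ)) (γ : SL(2, ℂ)) : P γ := by
  have hdet : ∀ γ : SL(2, ℂ), γ 0 0 * γ 1 1 - γ 0 1 * γ 1 0 = 1 := fun γ => by
    rw [← Matrix.det_fin_two]
    exact γ.2
  have key : ∀ γ : SL(2, ℂ), γ 1 0 ≠ 0 → P γ := by
    intro γ hc
    -- The two upper parameters are forced by the diagonal entries; the remaining entry then agrees
    -- because the determinant is `1`.
    have h : γ = upper ((γ 0 0 - 1) / γ 1 0) * lower (γ 1 0) * upper ((γ 1 1 - 1) / γ 1 0) := by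
      have hd := hdet γ
      ext i j
      fin_cases i <;> fin_cases j <;> simp [Matrix.mul_apply] <;> field_simp
      · ring
      · linear_combination -hd
      · ring
    rw [h]
    exact hm _ _ (hm _ _ (hu _) (hl _)) (hu _)
  by_cases hc : γ 1 0 = 0
  · have hd := hdet γ
    rw [hc, mul_zero, sub_zero] at hd
    -- Multiplication by `lower 1` changes the vanishing lower left entry into `γ 1 1`, which is
    -- nonzero because the determinant is `1`.
    have h : γ = γ * lower 1 * lower (-1) := by
      rw [mul_assoc, show lower 1 * lower (-1) = 1 from ?_, mul_one]
      ext i j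
      fin_cases i <;> fin_cases j <;> simp [Matrix.mul_apply]
    rw [h]
    refine hm _ _ (key _ ?_) (hl _)
    simpa [Matrix.mul_apply, hc] using right_ne_zero_of_mul_eq_one hd
  · exact key γ hc

end Generators

/-! ### Coordinates on `S^d ℂ²` and on its symmetric algebra. -/

section Coordinates

open MvPolynomial

/-- Both sides are `n`-th powers of their degree one parts, and these correspond because a basis
goes to the variables. -/
theorem map_symPow_equivMvPolynomial {κ V : Type*} [AddCommGroup V] [Module ℂ V]
    (b : Module.Basis κ ℂ V) (n : ℕ) :
    (symPow n V).map (SymmetricAlgebra.equivMvPolynomial b).toLinearMap =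
      homogeneousSubmodule κ ℂ n := by
  have h : (LinearMap.range (SymmetricAlgebra.ι ℂ V)).map
      (SymmetricAlgebra.equivMvPolynomial b).toAlgHom.toLinearMap =
        homogeneousSubmodule κ ℂ 1 := by
    rw [homogeneousSubmodule_one_eq_span_X, LinearMap.range_eq_map, ← b.span_eq, Submodule.map_span,
      Submodule.map_span, ← Set.range_comp, ← Set.range_comp]
    congr 2
    funext i
    exact SymmetricAlgebra.equivMvPolynomial_ι_apply b i
  rw [← homogeneousSubmodule_one_pow, ← h, ← Submodule.map_pow]
  rfl

theorem mem_symPow_iff {κ V : Type*} [AddCommGroup V] [Module ℂ V]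
    (b : Module.Basis κ ℂ V) (n : ℕ) (x : SymmetricAlgebra ℂ V) :
    x ∈ symPow n V ↔
      SymmetricAlgebra.equivMvPolynomial b x ∈ homogeneousSubmodule κ ℂ n := by
  rw [← map_symPow_equivMvPolynomial b]
  exact ((SymmetricAlgebra.equivMvPolynomial b).toLinearEquiv.injective.mem_set_image).symm

theorem equivMvPolynomial_coeffVector (d : ℕ) (i : Fin (d + 1)) :
    SymmetricAlgebra.equivMvPolynomial (Pi.basisFun ℂ (Fin 2)) (coeffVector d i : _) =
      monomial (Finsupp.single 0 (d - (i : ℕ)) + Finsupp.single 1 (i : ℕ)) 1 := by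
  have h : ∀ j : Fin 2, SymmetricAlgebra.equivMvPolynomial (Pi.basisFun ℂ (Fin 2))
      (SymmetricAlgebra.ι ℂ (Fin 2 → ℂ) (Pi.single j 1)) = X j := fun j => by
    rw [← Pi.basisFun_apply, SymmetricAlgebra.equivMvPolynomial_ι_apply]
  simp only [coeffVector, map_mul, map_pow, h, X_pow_eq_monomial, monomial_mul, mul_one]

theorem linearIndependent_coeffVector (d : ℕ) : LinearIndependent ℂ (coeffVector d) := by
  refine LinearIndependent.of_comp
    ((SymmetricAlgebra.equivMvPolynomial (Pi.basisFun ℂ (Fin 2))).toLinearMap ∘ₗ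
      (symPow d (Fin 2 → ℂ)).subtype) ?_
  have h : ((SymmetricAlgebra.equivMvPolynomial (Pi.basisFun ℂ (Fin 2))).toLinearMap ∘ₗ
      (symPow d (Fin 2 → ℂ)).subtype) ∘ coeffVector d =
      basisMonomials (Fin 2) ℂ ∘
        fun i : Fin (d + 1) => Finsupp.single 0 (d - (i : ℕ)) + Finsupp.single 1 (i : ℕ) := by
    funext i
    simpa using equivMvPolynomial_coeffVector d i
  rw [h]
  refine (basisMonomials (Fin 2) ℂ).linearIndependent.comp _ fun i j hij => ?_
  have := congrArg (fun ν => ν 1) hij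
  ext
  simpa using this

theorem span_coeffVector (d : ℕ) : ⊤ ≤ Submodule.span ℂ (Set.range (coeffVector d)) := by
  rintro ⟨x, hx⟩ -
  have hx' := (mem_symPow_iff (Pi.basisFun ℂ (Fin 2)) d x).mp hx
  set y := SymmetricAlgebra.equivMvPolynomial (Pi.basisFun ℂ (Fin 2)) x with hy
  have hν : ∀ ν ∈ y.support, ν 0 + ν 1 = d := by
    intro ν hν
    have := hx' (mem_support_iff.mp hν)
    rw [Finsupp.weight_apply, Finsupp.sum_fintype _ _ (by simp)] at this
    simpa using this
  have hsum : (⟨x, hx⟩ : SymC2 d) =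
      ∑ ν ∈ y.support.attach, coeff ν.1 y • coeffVector d ⟨ν.1 1, by
        have := hν ν.1 ν.2
        lia⟩ := by
    apply Subtype.ext
    apply (SymmetricAlgebra.equivMvPolynomial (Pi.basisFun ℂ (Fin 2))).injective
    rw [← hy, Submodule.coe_sum, map_sum]
    conv_lhs => rw [← support_sum_monomial_coeff y, ← Finset.sum_attach]
    refine Finset.sum_congr rfl fun ν _ => ?_
    rw [Submodule.coe_smul, map_smul, equivMvPolynomial_coeffVector, smul_monomial, smul_eq_mul,
      mul_one]
    refine congrArg (fun μ => monomial μ (coeff ν.1 y)) (Finsupp.ext fun j => ?_)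
    have := hν ν.1 ν.2
    fin_cases j
    · simp
      lia
    · simp
  rw [hsum]
  exact Submodule.sum_mem _ fun ν _ => Submodule.smul_mem _ _ (Submodule.subset_span ⟨_, rfl⟩)

/-- The basis `e₀^(d-i) e₁^i` of `S^d ℂ²`. -/
def coeffBasis (d : ℕ) : Module.Basis (Fin (d + 1)) ℂ (SymC2 d) :=
  Module.Basis.mk (linearIndependent_coeffVector d) (span_coeffVector d)

@[simp]
theorem coeffBasis_apply (d : ℕ) (i : Fin (d + 1)) : coeffBasis d i = coeffVector d i :=
  Module.Basis.mk_apply _ _ _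

/-- The vector `e₀^(d-n) e₁^n`, and `0` for `n > d`. -/
def coeffVec (d n : ℕ) : SymC2 d := if h : n < d + 1 then coeffVector d ⟨n, h⟩ else 0

theorem coeffVec_of_lt {d n : ℕ} (h : n < d + 1) : coeffVec d n = coeffVector d ⟨n, h⟩ := dif_pos h

theorem coeffVec_val {d : ℕ} (i : Fin (d + 1)) : coeffVec d i = coeffVector d i :=
  coeffVec_of_lt i.2

theorem coe_coeffVec {d n : ℕ} (h : n ≤ d) : (coeffVec d n : SymmetricAlgebra ℂ (Fin 2 → ℂ)) =
    SymmetricAlgebra.ι ℂ (Fin 2 → ℂ) (Pi.single 0 1) ^ (d - n) *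
      SymmetricAlgebra.ι ℂ (Fin 2 → ℂ) (Pi.single 1 1) ^ n := by
  rw [coeffVec_of_lt (by lia), coeffVector]

theorem coe_symC2Rep_coeffVec {d n : ℕ} (h : n ≤ d) (γ : SL(2, ℂ)) :
    (symC2Rep d γ (coeffVec d n) : SymmetricAlgebra ℂ (Fin 2 → ℂ)) =
    SymmetricAlgebra.ι ℂ (Fin 2 → ℂ) (stdRep γ (Pi.single 0 1)) ^ (d - n) *
      SymmetricAlgebra.ι ℂ (Fin 2 → ℂ) (stdRep γ (Pi.single 1 1)) ^ n := by
  change symAlgMap (stdRep γ) (coeffVec d n : SymmetricAlgebra ℂ (Fin 2 → ℂ)) = _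
  rw [coe_coeffVec h, map_mul, map_pow, map_pow, symAlgMap_ι, symAlgMap_ι]

theorem stdRep_single (γ : SL(2, ℂ)) (j : Fin 2) :
    stdRep γ (Pi.single j 1) = γ 0 j • Pi.single 0 1 + γ 1 j • Pi.single 1 1 := by
  change Matrix.toLin' (γ : Matrix (Fin 2) (Fin 2) ℂ) (Pi.single j 1) = _
  rw [Matrix.toLin'_apply, Matrix.mulVec_single_one]
  ext i
  fin_cases i <;> simp

theorem symC2Rep_upper {d n : ℕ} (h : n ≤ d) (t : ℂ) :
    symC2Rep d (upper t) (coeffVec d n) =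
      ∑ j ∈ Finset.range (n + 1), ((n.choose j : ℂ) * t ^ j) • coeffVec d (n - j) := by
  apply Subtype.ext
  rw [coe_symC2Rep_coeffVec h, stdRep_single, stdRep_single, Submodule.coe_sum]
  simp only [coe_upper, Matrix.of_apply, Matrix.cons_val', Matrix.cons_val_zero, Matrix.cons_val_one,
    Matrix.cons_val_fin_one, one_smul, zero_smul, add_zero, map_add, map_smul]
  rw [add_pow, Finset.mul_sum]
  refine Finset.sum_congr rfl fun j hj => ?_
  have hj' : j ≤ n := Nat.lt_succ_iff.mp (Finset.mem_range.mp hj)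
  rw [Submodule.coe_smul, coe_coeffVec (by lia), show d - (n - j) = d - n + j by lia, pow_add,
    Algebra.smul_def, Algebra.smul_def, map_mul, map_pow, map_natCast]
  ring

/-- Counting from the top exponent, the binomial expansion of `(e₀ + t e₁)^n` has the same shape as
the one for upper matrices. -/
theorem symC2Rep_lower {d n : ℕ} (h : n ≤ d) (t : ℂ) :
    symC2Rep d (lower t) (coeffVec d (d - n)) =
      ∑ j ∈ Finset.range (n + 1), ((n.choose j : ℂ) * t ^ j) • coeffVec d (d - (n - j)) := by
  apply Subtype.ext
  rw [coe_symC2Rep_coeffVec (by lia), stdRep_single, stdRep_single, Submodule.coe_sum]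
  simp only [coe_lower, Matrix.of_apply, Matrix.cons_val', Matrix.cons_val_zero, Matrix.cons_val_one,
    Matrix.cons_val_fin_one, one_smul, zero_smul, zero_add, map_add, map_smul]
  rw [add_comm, Nat.sub_sub_self h, add_pow, Finset.sum_mul]
  refine Finset.sum_congr rfl fun j hj => ?_
  have hj' : j ≤ n := Nat.lt_succ_iff.mp (Finset.mem_range.mp hj)
  rw [Submodule.coe_smul, coe_coeffVec (by lia), show d - (d - (n - j)) = n - j by lia,
    show d - (n - j) = d - n + j by lia, pow_add,
    Algebra.smul_def, Algebra.smul_def, map_mul, map_pow, map_natCast]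
  ring

theorem symC2Rep_weyl {d n : ℕ} (h : n ≤ d) :
    symC2Rep d weyl (coeffVec d n) = ((-1 : ℂ) ^ n) • coeffVec d (d - n) := by
  apply Subtype.ext
  rw [coe_symC2Rep_coeffVec h, stdRep_single, stdRep_single, Submodule.coe_smul,
    coe_coeffVec (by lia)]
  simp only [coe_weyl, Matrix.of_apply, Matrix.cons_val', Matrix.cons_val_zero, Matrix.cons_val_one,
    Matrix.cons_val_fin_one, one_smul, zero_smul, zero_add, add_zero, map_smul]
  rw [Nat.sub_sub_self h, smul_pow, mul_smul_comm, mul_comm]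

/-- Elements of the symmetric algebra of `S^d ℂ²` as polynomials in the coefficients. -/
def toCoeffs (d : ℕ) : SymmetricAlgebra ℂ (SymC2 d) ≃ₐ[ℂ] MvPolynomial (Fin (d + 1)) ℂ :=
  SymmetricAlgebra.equivMvPolynomial (coeffBasis d)

theorem toCoeffs_ι_coeffVec {d n : ℕ} :
    toCoeffs d (SymmetricAlgebra.ι ℂ (SymC2 d) (coeffVec d n)) = coeffVar d n := by
  unfold coeffVec coeffVar
  split_ifs with h
  · rw [← coeffBasis_apply, toCoeffs, SymmetricAlgebra.equivMvPolynomial_ι_apply]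
  · rw [map_zero, map_zero]

theorem toCoeffs_symm_eq (d : ℕ) (x : MvPolynomial (Fin (d + 1)) ℂ) :
    (toCoeffs d).symm x = ofCoeffs d x := by
  have h : ((toCoeffs d).symm : MvPolynomial (Fin (d + 1)) ℂ →ₐ[ℂ] _) = ofCoeffs d := by
    refine algHom_ext fun i => ?_
    rw [ofCoeffs, aeval_X, AlgEquiv.coe_toAlgHom, AlgEquiv.symm_apply_eq, ← coeffVec_val,
      toCoeffs_ι_coeffVec, coeffVar_val]
  exact congrArg (· x) h

theorem mem_plethysm_iff {g d : ℕ} (x : SymmetricAlgebra ℂ (SymC2 d)) :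
    x ∈ symPow g (SymC2 d) ↔ toCoeffs d x ∈ homogeneousSubmodule (Fin (d + 1)) ℂ g :=
  mem_symPow_iff (coeffBasis d) g x

/-- The action of `SL(2, ℂ)` on polynomials in the coefficients of a binary form. -/
def coeffAct (d : ℕ) (γ : SL(2, ℂ)) :
    MvPolynomial (Fin (d + 1)) ℂ →ₐ[ℂ] MvPolynomial (Fin (d + 1)) ℂ :=
  ((toCoeffs d : SymmetricAlgebra ℂ (SymC2 d) →ₐ[ℂ] _).comp (symAlgMap (symC2Rep d γ))).comp
    ((toCoeffs d).symm : _ →ₐ[ℂ] _)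

theorem coeffAct_toCoeffs (d : ℕ) (γ : SL(2, ℂ)) (x : SymmetricAlgebra ℂ (SymC2 d)) :
    coeffAct d γ (toCoeffs d x) = toCoeffs d (symAlgMap (symC2Rep d γ) x) := by
  simp [coeffAct]

theorem coeffAct_mul (d : ℕ) (γ δ : SL(2, ℂ)) (x : MvPolynomial (Fin (d + 1)) ℂ) :
    coeffAct d (γ * δ) x = coeffAct d γ (coeffAct d δ x) := by
  obtain ⟨x, rfl⟩ := (toCoeffs d).surjective x
  rw [coeffAct_toCoeffs, coeffAct_toCoeffs, coeffAct_toCoeffs, map_mul, Module.End.mul_eq_comp,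
    symAlgMap_comp, AlgHom.comp_apply]

theorem coeffAct_one (d : ℕ) (x : MvPolynomial (Fin (d + 1)) ℂ) : coeffAct d 1 x = x := by
  obtain ⟨x, rfl⟩ := (toCoeffs d).surjective x
  rw [coeffAct_toCoeffs, map_one, symAlgMap_one, AlgHom.id_apply]

theorem coeffAct_coeffVar (d n : ℕ) (γ : SL(2, ℂ)) : coeffAct d γ (coeffVar d n) =
    toCoeffs d (SymmetricAlgebra.ι ℂ (SymC2 d) (symC2Rep d γ (coeffVec d n))) := by
  rw [← toCoeffs_ι_coeffVec, coeffAct_toCoeffs, symAlgMap_ι]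

theorem coeffAct_upper (d : ℕ) (t : ℂ) : coeffAct d (upper t) = upperAct d t := by
  refine algHom_ext fun i => ?_
  rw [upperAct, aeval_X, ← coeffVar_val, coeffAct_coeffVar, symC2Rep_upper (by lia), map_sum,
    map_sum]
  refine Finset.sum_congr rfl fun j _ => ?_
  rw [map_smul, map_smul, toCoeffs_ι_coeffVec]

theorem coeffAct_weyl (d : ℕ) : coeffAct d weyl = weylAct d := by
  refine algHom_ext fun i => ?_
  rw [weylAct, aeval_X, ← coeffVar_val, coeffAct_coeffVar, symC2Rep_weyl (by lia), map_smul,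
    map_smul, toCoeffs_ι_coeffVec]

theorem weylAct_coeffAct_inv (d : ℕ) (x : MvPolynomial (Fin (d + 1)) ℂ) :
    weylAct d (coeffAct d weyl⁻¹ x) = x := by
  rw [← coeffAct_weyl, ← coeffAct_mul, mul_inv_cancel, coeffAct_one]

theorem coeffAct_inv_weylAct (d : ℕ) (x : MvPolynomial (Fin (d + 1)) ℂ) :
    coeffAct d weyl⁻¹ (weylAct d x) = x := by
  rw [← coeffAct_weyl, ← coeffAct_mul, inv_mul_cancel, coeffAct_one]

theorem opD_coeffAct_inv (d : ℕ) (x : MvPolynomial (Fin (d + 1)) ℂ) :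
    opD d (coeffAct d weyl⁻¹ x) = -coeffAct d weyl⁻¹ (opF d x) := by
  have h' : weylAct d (opD d (coeffAct d weyl⁻¹ x)) = -opF d x := by
    rw [weylAct_opD, weylAct_coeffAct_inv]
  rw [← coeffAct_inv_weylAct d (opD d _), h', map_neg]

theorem coeffAct_lower (d : ℕ) (t : ℂ) (x : MvPolynomial (Fin (d + 1)) ℂ) :
    coeffAct d (lower t) x = weylAct d (upperAct d (-t) (coeffAct d weyl⁻¹ x)) := by
  rw [lower_eq, coeffAct_mul, coeffAct_mul, coeffAct_weyl, coeffAct_upper]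

theorem coeffAct_lower_of_string {d : ℕ} {y : ℕ → MvPolynomial (Fin (d + 1)) ℂ} {e : ℕ}
    (hy : ∀ i ≤ e, opF d (y i) = ((e : ℂ) - i) • y (i + 1)) (t : ℂ) {i : ℕ} (hi : i ≤ e) :
    coeffAct d (lower t) (y (e - i)) =
      ∑ j ∈ Finset.range (i + 1), ((i.choose j : ℂ) * t ^ j) • y (e - (i - j)) := by
  -- The reversed string, carried over by the inverse Weyl element, is a string for `opD`; the
  -- alternating signs absorb the one in `opD_coeffAct_inv`.
  have hz : ∀ k ≤ e, opD d (((-1 : ℂ) ^ k) • coeffAct d weyl⁻¹ (y (e - k))) =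
      (k : ℂ) • ((-1 : ℂ) ^ (k - 1)) • coeffAct d weyl⁻¹ (y (e - (k - 1))) := by
    intro k hk
    rw [Derivation.map_smul, opD_coeffAct_inv, hy _ (by lia), map_smul, Nat.cast_sub hk]
    cases k with
    | zero => simp
    | succ k =>
      rw [Nat.add_sub_cancel, show e - (k + 1) + 1 = e - k by lia, pow_succ]
      module
  have hu := upperAct_of_string
    (y := fun k => ((-1 : ℂ) ^ k) • coeffAct d weyl⁻¹ (y (e - k))) hz (-t) hi
  have h2 : coeffAct d weyl⁻¹ (y (e - i)) = ((-1 : ℂ) ^ i) • (((-1 : ℂ) ^ i) •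
      coeffAct d weyl⁻¹ (y (e - i))) := by
    rw [smul_smul, ← mul_pow]
    simp
  rw [coeffAct_lower, h2, map_smul, hu, map_smul, map_sum, Finset.smul_sum]
  refine Finset.sum_congr rfl fun j hj => ?_
  have hj' : j ≤ i := Nat.lt_succ_iff.mp (Finset.mem_range.mp hj)
  rw [map_smul, map_smul, weylAct_coeffAct_inv, smul_smul, smul_smul]
  congr 1
  obtain ⟨k, rfl⟩ := Nat.exists_eq_add_of_le hj'
  have hs : ((-1 : ℂ) ^ j) * (-1) ^ j = 1 := by rw [← mul_pow]; simp
  have hs' : ((-1 : ℂ) ^ k) * (-1) ^ k = 1 := by rw [← mul_pow]; simp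
  rw [Nat.add_sub_cancel_left, neg_pow t, pow_add]
  linear_combination (((j + k).choose j : ℂ) * t ^ j) * ((-1 : ℂ) ^ k * (-1) ^ k) * hs +
    (((j + k).choose j : ℂ) * t ^ j) * hs'

end Coordinates

/-! ### The copy of `S^e ℂ²` generated by a highest weight vector. -/

section Strings

open MvPolynomial

variable {g d : ℕ}

/-- The vectors `(e-i)!/e! F^i v`. -/
def weightString (d e : ℕ) (v : MvPolynomial (Fin (d + 1)) ℂ) (i : ℕ) :
    MvPolynomial (Fin (d + 1)) ℂ :=
  (((e - i).factorial : ℂ) / e.factorial) • (opF d)^[i] v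

theorem weightString_zero (d e : ℕ) (v : MvPolynomial (Fin (d + 1)) ℂ) :
    weightString d e v 0 = v := by
  simp [weightString, div_self (Nat.cast_ne_zero.mpr e.factorial_ne_zero : (e.factorial : ℂ) ≠ 0)]

/-- The normalization `(e-i)!/e!` is chosen so that raising and lowering have the structure
constants `i` and `e - i` of the vectors `e₀^(e-i) e₁^i` in `S^e ℂ²`. -/
theorem opD_weightString {q e : ℕ} {v : MvPolynomial (Fin (d + 1)) ℂ} (hv : v ∈ kerD g q d)
    (he : 2 * q + e = d * g) {i : ℕ} (hi : i ≤ e) :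
    opD d (weightString d e v i) = (i : ℂ) • weightString d e v (i - 1) := by
  rw [weightString, Derivation.map_smul]
  cases i with
  | zero =>
    have h0 : opD d v = 0 := hv.2
    simp [h0]
  | succ i =>
    have he' : (2 : ℂ) * q + e = d * g := by exact_mod_cast he
    rw [opD_opF_iterate hv, weightString, Nat.add_sub_cancel, smul_smul, smul_smul]
    congr 1
    obtain ⟨k, rfl⟩ := Nat.exists_eq_add_of_le hi
    rw [show i + 1 + k - i = k + 1 by lia, Nat.add_sub_cancel_left, Nat.factorial_succ, ← he']
    push_cast
    ring

theorem opF_weightString {q e : ℕ} {v : MvPolynomial (Fin (d + 1)) ℂ} (hv : v ∈ kerD g q d)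
    (he : 2 * q + e = d * g) {i : ℕ} (hi : i ≤ e) :
    opF d (weightString d e v i) = ((e : ℂ) - i) • weightString d e v (i + 1) := by
  rw [weightString, Derivation.map_smul, ← Function.iterate_succ_apply' (opF d), weightString]
  rcases hi.eq_or_lt with rfl | h
  -- At the end of the string the factorials with truncated subtraction no longer match, but
  -- `F^(e+1) v = 0`.
  · rw [opF_iterate_eq_zero hv he (by lia), smul_zero, smul_zero, smul_zero]
  · rw [smul_smul]
    congr 1
    obtain ⟨k, rfl⟩ := Nat.exists_eq_add_of_lt h
    rw [show i + k + 1 - i = k + 1 by lia, show i + k + 1 - (i + 1) = k by lia,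
      Nat.factorial_succ]
    push_cast
    ring

theorem weightString_mem {q : ℕ} {v : MvPolynomial (Fin (d + 1)) ℂ} (hv : v ∈ kerD g q d)
    (e i : ℕ) : weightString d e v i ∈ homogeneousSubmodule (Fin (d + 1)) ℂ g :=
  Submodule.smul_mem _ _ (opF_iterate_mem hv.1 i).1

/-- The linear map `S^e ℂ² ⊗ I → ℂ[a₀, …, a_d]` sending `e₀^(e-i) e₁^i ⊗ v` to
`(e-i)!/e! F^i v`. -/
def stringMap (d e : ℕ) (I : Submodule ℂ (MvPolynomial (Fin (d + 1)) ℂ)) :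
    SymC2 e ⊗[ℂ] I →ₗ[ℂ] MvPolynomial (Fin (d + 1)) ℂ :=
  TensorProduct.lift ((coeffBasis e).constr ℂ fun i =>
    (((e - (i : ℕ)).factorial : ℂ) / e.factorial) •
      ((opF d).toLinearMap ^ (i : ℕ)) ∘ₗ I.subtype)

theorem stringMap_tmul {e n : ℕ} (hn : n ≤ e) (I : Submodule ℂ (MvPolynomial (Fin (d + 1)) ℂ))
    (v : I) : stringMap d e I (coeffVec e n ⊗ₜ v) = weightString d e v n := by
  rw [stringMap, TensorProduct.lift.tmul, coeffVec_of_lt (by lia), ← coeffBasis_apply,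
    Module.Basis.constr_basis, weightString, LinearMap.smul_apply, LinearMap.comp_apply,
    Module.End.pow_apply]
  rfl

/-- On each unipotent generator the action on a string is determined by the raising or the lowering
relations, and these agree on the two sides. -/
theorem stringMap_equivariant {q e : ℕ} (he : 2 * q + e = d * g) (γ : SL(2, ℂ))
    (x : SymC2 e ⊗[ℂ] kerD g q d) :
    stringMap d e (kerD g q d)
        ((symC2Rep e).tprod (Representation.trivial ℂ SL(2, ℂ) (kerD g q d)) γ x) =
      coeffAct d γ (stringMap d e (kerD g q d) x) := by
  induction γ using sl2_induction generalizing x with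
  | hm γ δ hγ hδ => rw [map_mul, Module.End.mul_apply, hγ, hδ, coeffAct_mul]
  | hu t =>
    suffices h : stringMap d e (kerD g q d) ∘ₗ
        (symC2Rep e).tprod (Representation.trivial ℂ SL(2, ℂ) (kerD g q d)) (upper t) =
        (coeffAct d (upper t)).toLinearMap ∘ₗ stringMap d e (kerD g q d) from
      congrArg (· x) h
    refine TensorProduct.ext ((coeffBasis e).ext fun i => LinearMap.ext fun v => ?_)
    have hi : (i : ℕ) ≤ e := by lia
    simp only [LinearMap.compr₂ₛₗ_apply, TensorProduct.mk_apply, LinearMap.comp_apply,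
      AlgHom.toLinearMap_apply, coeffBasis_apply, ← coeffVec_val, Representation.tprod_apply,
      TensorProduct.map_tmul, Representation.trivial_apply, symC2Rep_upper hi,
      TensorProduct.sum_tmul, ← TensorProduct.smul_tmul', map_sum, map_smul, coeffAct_upper]
    rw [stringMap_tmul hi, upperAct_of_string (fun i hi => opD_weightString v.2 he hi) t hi]
    refine Finset.sum_congr rfl fun j _ => ?_
    rw [stringMap_tmul (by lia)]
  | hl t =>
    suffices h : stringMap d e (kerD g q d) ∘ₗ
        (symC2Rep e).tprod (Representation.trivial ℂ SL(2, ℂ) (kerD g q d)) (lower t) =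
        (coeffAct d (lower t)).toLinearMap ∘ₗ stringMap d e (kerD g q d) from
      congrArg (· x) h
    refine TensorProduct.ext ((coeffBasis e).ext fun i => LinearMap.ext fun v => ?_)
    obtain ⟨n, hn, hi⟩ : ∃ n ≤ e, (i : ℕ) = e - n := ⟨e - i, by lia, by lia⟩
    simp only [LinearMap.compr₂ₛₗ_apply, TensorProduct.mk_apply, LinearMap.comp_apply,
      AlgHom.toLinearMap_apply, coeffBasis_apply, ← coeffVec_val, hi, Representation.tprod_apply,
      TensorProduct.map_tmul, Representation.trivial_apply, symC2Rep_lower hn,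
      TensorProduct.sum_tmul, ← TensorProduct.smul_tmul', map_sum, map_smul]
    rw [stringMap_tmul (by lia),
      coeffAct_lower_of_string (fun i hi => opF_weightString v.2 he hi) t hn]
    refine Finset.sum_congr rfl fun j _ => ?_
    rw [stringMap_tmul (by lia)]

/-- The coordinates of an element of `S^e ℂ² ⊗ I`. -/
abbrev tensorCoord (e : ℕ) (I : Submodule ℂ (MvPolynomial (Fin (d + 1)) ℂ)) :
    SymC2 e ⊗[ℂ] I ≃ₗ[ℂ] Fin (e + 1) →₀ I :=
  TensorProduct.equivFinsuppOfBasisLeft (coeffBasis e)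

theorem tensorCoord_sum (e : ℕ) (I : Submodule ℂ (MvPolynomial (Fin (d + 1)) ℂ))
    (x : SymC2 e ⊗[ℂ] I) : x = ∑ i : Fin (e + 1), coeffVec e i ⊗ₜ tensorCoord e I x i := by
  conv_lhs => rw [← (tensorCoord e I).symm_apply_apply x,
    TensorProduct.equivFinsuppOfBasisLeft_symm_apply, Finsupp.sum_fintype _ _ (by simp)]
  simp only [coeffBasis_apply, coeffVec_val]

/-- The raising operator on `S^e ℂ²`. -/
def raise (e : ℕ) : SymC2 e →ₗ[ℂ] SymC2 e :=
  (coeffBasis e).constr ℂ fun i => ((i : ℕ) : ℂ) • coeffVec e (i - 1)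

theorem raise_coeffVec {e n : ℕ} (hn : n ≤ e) :
    raise e (coeffVec e n) = (n : ℂ) • coeffVec e (n - 1) := by
  rw [coeffVec_of_lt (by lia), ← coeffBasis_apply, raise, Module.Basis.constr_basis]

theorem tensorCoord_coeffVec_tmul {e n : ℕ} (hn : n ≤ e)
    (I : Submodule ℂ (MvPolynomial (Fin (d + 1)) ℂ)) (v : I) (k : Fin (e + 1)) :
    tensorCoord e I (coeffVec e n ⊗ₜ v) k = if n = k then v else 0 := by
  rw [TensorProduct.equivFinsuppOfBasisLeft_apply_tmul_apply, coeffVec_of_lt (by lia),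
    ← coeffBasis_apply, Module.Basis.repr_self, Finsupp.single_apply]
  simp [Fin.ext_iff]

theorem tensorCoord_raise_last {e : ℕ} (I : Submodule ℂ (MvPolynomial (Fin (d + 1)) ℂ))
    (x : SymC2 e ⊗[ℂ] I) : tensorCoord e I ((raise e).rTensor I x) (Fin.last e) = 0 := by
  suffices h : Finsupp.lapply (Fin.last e) ∘ₗ (tensorCoord e I).toLinearMap ∘ₗ
      (raise e).rTensor I = 0 from congrArg (· x) h
  refine TensorProduct.ext ((coeffBasis e).ext fun j => LinearMap.ext fun v => ?_)
  simp only [LinearMap.compr₂ₛₗ_apply, TensorProduct.mk_apply, LinearMap.comp_apply,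
    LinearMap.zero_apply, Finsupp.lapply_apply, LinearEquiv.coe_coe, LinearMap.rTensor_tmul,
    coeffBasis_apply, ← coeffVec_val]
  rw [raise_coeffVec (by lia), ← TensorProduct.smul_tmul', map_smul, Finsupp.smul_apply,
    tensorCoord_coeffVec_tmul (by lia)]
  rcases Nat.eq_zero_or_pos (j : ℕ) with h | h
  · simp [h]
  · rw [if_neg (by simp only [Fin.val_last]; lia), smul_zero]

/-- Raising shifts the coordinates down by one with nonzero factors. It shortens the support, and it
kills only the tensors supported in coordinate `0`; the injectivity proof uses both. -/
theorem tensorCoord_raise {e : ℕ} (I : Submodule ℂ (MvPolynomial (Fin (d + 1)) ℂ))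
    (x : SymC2 e ⊗[ℂ] I) (i : Fin e) :
    tensorCoord e I ((raise e).rTensor I x) i.castSucc =
      ((i : ℂ) + 1) • tensorCoord e I x i.succ := by
  suffices h : Finsupp.lapply i.castSucc ∘ₗ (tensorCoord e I).toLinearMap ∘ₗ (raise e).rTensor I =
      ((i : ℂ) + 1) • Finsupp.lapply i.succ ∘ₗ (tensorCoord e I).toLinearMap from
    congrArg (· x) h
  refine TensorProduct.ext ((coeffBasis e).ext fun j => LinearMap.ext fun v => ?_)
  simp only [LinearMap.compr₂ₛₗ_apply, TensorProduct.mk_apply, LinearMap.comp_apply,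
    LinearMap.smul_apply, Finsupp.lapply_apply, LinearEquiv.coe_coe, LinearMap.rTensor_tmul,
    coeffBasis_apply, ← coeffVec_val]
  rw [raise_coeffVec (by lia), ← TensorProduct.smul_tmul', map_smul, Finsupp.smul_apply,
    tensorCoord_coeffVec_tmul (by lia),
    tensorCoord_coeffVec_tmul (by lia)]
  by_cases hj : (j : ℕ) = i + 1
  · simp [hj]
  -- Truncated subtraction allows a spurious match at `j = 0`, where the scalar `j` vanishes.
  · have : (j : ℕ) - 1 = i → (j : ℕ) = 0 := by lia
    by_cases hj' : (j : ℕ) - 1 = i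
    · simp [this hj']
    · simp [hj, hj']

theorem stringMap_raise {q e : ℕ} (he : 2 * q + e = d * g) (x : SymC2 e ⊗[ℂ] kerD g q d) :
    stringMap d e (kerD g q d) ((raise e).rTensor _ x) =
      opD d (stringMap d e (kerD g q d) x) := by
  suffices h : stringMap d e (kerD g q d) ∘ₗ (raise e).rTensor _ =
      (opD d).toLinearMap ∘ₗ stringMap d e (kerD g q d) from congrArg (· x) h
  refine TensorProduct.ext ((coeffBasis e).ext fun i => LinearMap.ext fun v => ?_)
  have hi : (i : ℕ) ≤ e := by lia
  simp only [LinearMap.compr₂ₛₗ_apply, TensorProduct.mk_apply, LinearMap.comp_apply,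
    coeffBasis_apply, ← coeffVec_val, LinearMap.rTensor_tmul, Derivation.coeFn_coe]
  rw [raise_coeffVec hi, ← TensorProduct.smul_tmul', map_smul, stringMap_tmul (by lia),
    stringMap_tmul hi, opD_weightString v.2 he hi]

end Strings

/-! ### The isotypic decomposition of `S^g (S^d ℂ²)`. -/

section Decomposition

open MvPolynomial

variable {g d : ℕ}

theorem two_mul_add_exponent (e : Exponent g d) : 2 * ((d * g - e) / 2) + e = d * g := by
  have h := Nat.two_mul_div_two_of_even e.2.2
  have := e.2.1
  lia

instance finite_exponent (g d : ℕ) : Finite (Exponent g d) :=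
  (Set.finite_Iic (d * g)).subset (fun _ h => h.1)

/-- The representation space `⨁ S^e ℂ² ⊗ I_{g,(dg-e)/2,d}`. -/
abbrev Isotypic (g d : ℕ) : Type :=
  ⨁ e : Exponent g d, SymC2 e ⊗[ℂ] kerD g ((d * g - e) / 2) d

/-- The action of `SL(2, ℂ)` on `⨁ S^e ℂ² ⊗ I_{g,(dg-e)/2,d}`. -/
abbrev isotypicRep (g d : ℕ) : Representation ℂ SL(2, ℂ) (Isotypic g d) :=
  Representation.directSum fun e : Exponent g d =>
    (symC2Rep e).tprod (Representation.trivial ℂ SL(2, ℂ) (kerD g ((d * g - e) / 2) d))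

/-- The sum of the maps `stringMap`. -/
def isotypicMap (g d : ℕ) : Isotypic g d →ₗ[ℂ] MvPolynomial (Fin (d + 1)) ℂ :=
  DirectSum.toModule ℂ _ _ fun e => stringMap d e _

theorem isotypicMap_lof (e : Exponent g d) (x : SymC2 e ⊗[ℂ] kerD g ((d * g - e) / 2) d) :
    isotypicMap g d (DirectSum.lof ℂ _ _ e x) = stringMap d e _ x :=
  DirectSum.toModule_lof _ _ _

theorem isotypicMap_equivariant (γ : SL(2, ℂ)) (x : Isotypic g d) :
    isotypicMap g d (isotypicRep g d γ x) = coeffAct d γ (isotypicMap g d x) := by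
  classical
  suffices h : isotypicMap g d ∘ₗ isotypicRep g d γ =
      (coeffAct d γ).toLinearMap ∘ₗ isotypicMap g d from congrArg (· x) h
  refine DirectSum.linearMap_ext _ fun e => LinearMap.ext fun y => ?_
  simp only [LinearMap.comp_apply, Representation.directSum_apply, DirectSum.lmap_lof,
    AlgHom.toLinearMap_apply, isotypicMap_lof]
  exact stringMap_equivariant (two_mul_add_exponent e) γ y

theorem isotypicMap_eq_sum [Fintype (Exponent g d)] (x : Isotypic g d) :
    isotypicMap g d x = ∑ e : Exponent g d, stringMap d e _ (x e) := by
  classical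
  conv_lhs => rw [← DirectSum.sum_univ_of x]
  rw [map_sum]
  exact Finset.sum_congr rfl fun e _ => isotypicMap_lof e (x e)

theorem isotypicMap_raise (x : Isotypic g d) :
    isotypicMap g d (DirectSum.lmap (fun e : Exponent g d => (raise e).rTensor _) x) =
      opD d (isotypicMap g d x) := by
  classical
  suffices h : isotypicMap g d ∘ₗ DirectSum.lmap (fun e : Exponent g d => (raise e).rTensor _) =
      (opD d).toLinearMap ∘ₗ isotypicMap g d from congrArg (· x) h
  refine DirectSum.linearMap_ext _ fun e => LinearMap.ext fun y => ?_
  simp only [LinearMap.comp_apply, DirectSum.lmap_lof, isotypicMap_lof, Derivation.coeFn_coe]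
  exact stringMap_raise (two_mul_add_exponent e) y

/-- Distinct exponents `e` give distinct weights `(dg - e)/2`, so the summands are separated by
their weighted homogeneous components. -/
theorem eq_zero_of_sum_eq_zero [Fintype (Exponent g d)]
    (m : ∀ e : Exponent g d, kerD g ((d * g - e) / 2) d)
    (h : ∑ e, (m e : MvPolynomial (Fin (d + 1)) ℂ) = 0) (e : Exponent g d) : m e = 0 := by
  have h' := congrArg (weightedHomogeneousComponent (fun i : Fin (d + 1) => (i : ℕ))
    ((d * g - e) / 2)) h
  rw [map_sum, map_zero, Finset.sum_eq_single e] at h'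
  · rw [weightedHomogeneousComponent_of_mem (m e).2.1.2, if_pos rfl] at h'
    exact Subtype.ext h'
  · intro e' _ hne
    rw [weightedHomogeneousComponent_of_mem (m e').2.1.2, if_neg]
    intro heq
    apply hne
    have h1 := two_mul_add_exponent e
    have h2 := two_mul_add_exponent e'
    ext
    lia
  · simp

theorem isotypicMap_injective (g d : ℕ) : Function.Injective (isotypicMap g d) := by
  classical
  have := Fintype.ofFinite (Exponent g d)
  let _ : AddCommGroup (Isotypic g d) := Module.addCommMonoidToAddCommGroup ℂ
  rw [injective_iff_map_eq_zero]
  -- Induction on a bound `n` for the coordinates that occur. Raising a kernel element stays in the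
  -- kernel and lowers the bound, so the raised element vanishes. Only the coordinates `0` survive,
  -- and they map to a sum of highest weight vectors of distinct weights.
  suffices H : ∀ n, ∀ x : Isotypic g d,
      (∀ e : Exponent g d, ∀ i : Fin ((e : ℕ) + 1), n ≤ (i : ℕ) → tensorCoord e _ (x e) i = 0) →
      isotypicMap g d x = 0 → x = 0 by
    intro x
    refine H (d * g + 1) x fun e i hi => ?_
    have := e.2.1
    have := i.2
    lia
  intro n
  induction n with
  | zero =>
    intro x hx _
    refine DFinsupp.ext fun e => ?_
    apply (tensorCoord (e : ℕ) _).injective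
    ext1 i
    rw [hx e i (Nat.zero_le _), DirectSum.zero_apply, LinearEquiv.map_zero, Finsupp.zero_apply]
  | succ n ih =>
    intro x hx h0
    have hr : DirectSum.lmap (fun e : Exponent g d => (raise e).rTensor _) x = 0 := by
      refine ih _ (fun e i hi => ?_) (by rw [isotypicMap_raise, h0, map_zero])
      rw [DirectSum.lmap_apply]
      induction i using Fin.lastCases with
      | cast i =>
        rw [tensorCoord_raise, hx e i.succ (by simpa using hi), smul_zero]
      | last => exact tensorCoord_raise_last _ _
    have hz : ∀ (e : Exponent g d) (i : Fin e), tensorCoord e _ (x e) i.succ = 0 := by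
      intro e i
      have h1 := tensorCoord_raise _ (x e) i
      have h2 := congrArg (fun y => tensorCoord e _ (y e) i.castSucc) hr
      simp only [DirectSum.lmap_apply] at h2
      rw [h2, DirectSum.zero_apply, LinearEquiv.map_zero, Finsupp.zero_apply, eq_comm, smul_eq_zero] at h1
      exact h1.resolve_left (by exact_mod_cast Nat.succ_ne_zero i)
    have hx0 : ∀ e : Exponent g d, x e = coeffVec e 0 ⊗ₜ tensorCoord e _ (x e) 0 := by
      intro e
      conv_lhs => rw [tensorCoord_sum _ _ (x e), Fin.sum_univ_succ]
      simp [hz]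
    rw [isotypicMap_eq_sum] at h0
    have hm := eq_zero_of_sum_eq_zero (fun e => tensorCoord e _ (x e) 0) (by
      rw [← h0]
      refine Finset.sum_congr rfl fun e _ => ?_
      conv_rhs => rw [hx0 e]
      rw [stringMap_tmul (by lia), weightString_zero])
    refine DFinsupp.ext fun e => ?_
    rw [hx0 e, hm e, TensorProduct.tmul_zero]
    rfl

theorem range_isotypicMap (g d : ℕ) :
    LinearMap.range (isotypicMap g d) = homogeneousSubmodule (Fin (d + 1)) ℂ g := by
  classical
  apply le_antisymm
  · have := Fintype.ofFinite (Exponent g d)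
    rintro _ ⟨x, rfl⟩
    rw [isotypicMap_eq_sum]
    refine Submodule.sum_mem _ fun e _ => ?_
    rw [tensorCoord_sum _ _ (x e), map_sum]
    refine Submodule.sum_mem _ fun i _ => ?_
    rw [stringMap_tmul (by lia)]
    exact weightString_mem (Subtype.property _) _ _
  have hlow : ∀ p, 2 * p ≤ d * g → weightSpace g p d ≤ LinearMap.range (isotypicMap g d) := by
    intro p hp
    refine weightSpace_le_of_lowered_mem hp _ fun q k hqk u hu => ?_
    -- The highest weight of the string through `u`; since `q + k = p ≤ dg/2`, the position `k` lies
    -- within it.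
    let e : Exponent g d := ⟨d * g - 2 * q, by lia, by
      rw [Nat.sub_sub_self (by lia)]
      exact even_two_mul q⟩
    have hq : (d * g - (e : ℕ)) / 2 = q := by
      have := two_mul_add_exponent e
      simp only [e] at this ⊢
      lia
    have hc : (((d * g - 2 * q - k).factorial : ℂ) / (d * g - 2 * q).factorial) ≠ 0 :=
      div_ne_zero (Nat.cast_ne_zero.mpr (Nat.factorial_ne_zero _))
        (Nat.cast_ne_zero.mpr (Nat.factorial_ne_zero _))
    have h := isotypicMap_lof e (coeffVec e k ⊗ₜ ⟨u, by rwa [hq]⟩)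
    rw [stringMap_tmul (by simp only [e]; lia), weightString] at h
    rw [← inv_smul_smul₀ hc ((opF d)^[k] u)]
    exact Submodule.smul_mem _ _ ⟨_, h⟩
  intro x hx
  rw [← support_sum_monomial_coeff x]
  refine Submodule.sum_mem _ fun ν hν => ?_
  obtain ⟨p, hp⟩ : ∃ p, monomial ν (coeff ν x) ∈ weightSpace g p d :=
    ⟨_, isHomogeneous_monomial _ (by
      rw [Finsupp.degree_eq_weight_one]
      exact hx (mem_support_iff.mp hν)), isWeightedHomogeneous_monomial _ _ _ rfl⟩
  by_cases h1 : 2 * p ≤ d * g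
  · exact hlow p h1 hp
  by_cases h2 : p ≤ d * g
  -- Weights beyond the middle are reflected by the Weyl element into the range already treated, and
  -- equivariance brings the preimage back.
  · obtain ⟨y, hy⟩ := hlow (d * g - p) (by lia) (weylAct_mem h2 hp)
    refine ⟨isotypicRep g d weyl⁻¹ y, ?_⟩
    rw [isotypicMap_equivariant, hy, coeffAct_inv_weylAct]
  · rw [eq_zero_of_mem_weightSpace hp (by lia)]
    exact Submodule.zero_mem _

theorem nonempty_plethysm_equiv (g d : ℕ) :
    Nonempty ((plethysmRep g d).Equiv (isotypicRep g d)) := by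
  have hmem : ∀ x, (toCoeffs d).symm (isotypicMap g d x) ∈ symPow g (SymC2 d) := by
    intro x
    rw [mem_plethysm_iff, AlgEquiv.apply_symm_apply, ← range_isotypicMap]
    exact ⟨x, rfl⟩
  let f : Isotypic g d →ₗ[ℂ] Plethysm g d :=
    ((toCoeffs d).symm.toLinearMap ∘ₗ isotypicMap g d).codRestrict _ hmem
  have hbij : Function.Bijective f := by
    constructor
    · intro x y hxy
      exact isotypicMap_injective g d ((toCoeffs d).symm.injective (congrArg Subtype.val hxy))
    · rintro ⟨y, hy⟩
      rw [mem_plethysm_iff, ← range_isotypicMap] at hy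
      obtain ⟨x, hx⟩ := hy
      refine ⟨x, Subtype.ext ?_⟩
      change (toCoeffs d).symm (isotypicMap g d x) = y
      rw [hx, AlgEquiv.symm_apply_apply]
  refine ⟨(Representation.Equiv.mk (LinearEquiv.ofBijective f hbij) fun γ =>
    LinearMap.ext fun x => Subtype.ext ?_).symm⟩
  change (toCoeffs d).symm (isotypicMap g d (isotypicRep g d γ x)) =
    symAlgMap (symC2Rep d γ) ((toCoeffs d).symm (isotypicMap g d x))
  rw [isotypicMap_equivariant, AlgEquiv.symm_apply_eq, ← coeffAct_toCoeffs,
    AlgEquiv.apply_symm_apply]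

end Decomposition

/-! ### Invariants as the kernel of `opD` in the middle weight. -/

section Invariants

open MvPolynomial

variable {g d : ℕ}

theorem mem_kerD_iff_invariant {p : ℕ} (hp : 2 * p = d * g) (x : MvPolynomial (Fin (d + 1)) ℂ) :
    x ∈ kerD g p d ↔
      x ∈ homogeneousSubmodule (Fin (d + 1)) ℂ g ∧ ∀ γ, coeffAct d γ x = x := by
  constructor
  · intro hx
    -- The string through `x` has `e = 0`, hence length one.
    have hF : opF d x = 0 := opF_iterate_eq_zero (k := 1) hx (e := 0) hp (by lia)
    refine ⟨hx.1.1, fun γ => ?_⟩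
    induction γ using sl2_induction with
    | hu t => rw [coeffAct_upper, upperAct_of_opD_eq_zero hx.2]
    | hl t =>
      rw [coeffAct_lower, upperAct_of_opD_eq_zero (by rw [opD_coeffAct_inv, hF, map_zero, neg_zero]),
        weylAct_coeffAct_inv]
    | hm γ δ hγ hδ => rw [coeffAct_mul, hδ, hγ]
  · rintro ⟨hg, hx⟩
    have hD : opD d x = 0 := opD_eq_zero_of_upperAct fun t => by rw [← coeffAct_upper, hx]
    have hF : opF d x = 0 := by
      have h := weylAct_opD x
      rw [hD, map_zero, ← coeffAct_weyl, hx, eq_comm, neg_eq_zero] at h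
      exact h
    have hN := mem_homogeneousSubmodule_iff_opN.mp hg
    refine ⟨mem_weightSpace.mpr ⟨hN, ?_⟩, hD⟩
    -- Both operators kill `x`, so the commutator gives `dg x = 2 W x`, and the weight is the middle
    -- one.
    have h := opD_opF x
    rw [hF, hD, map_zero, map_zero, zero_add, hN, eq_comm, sub_eq_zero] at h
    have hp' : (2 : ℂ) * p = d * g := by exact_mod_cast hp
    refine smul_right_injective _ (two_ne_zero (α := ℂ)) ?_
    simp only
    rw [← h, smul_smul, smul_smul, hp']

theorem map_kerD_eq_invariants {p : ℕ} (hp : 2 * p = d * g) :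
    (kerD g p d).map (ofCoeffs d).toLinearMap =
      (plethysmRep g d).invariants.map (symPow g (SymC2 d)).subtype := by
  have key : ∀ y : SymmetricAlgebra ℂ (SymC2 d), toCoeffs d y ∈ kerD g p d ↔
      y ∈ symPow g (SymC2 d) ∧ ∀ γ, symAlgMap (symC2Rep d γ) y = y := by
    intro y
    rw [mem_kerD_iff_invariant hp, ← mem_plethysm_iff]
    simp only [coeffAct_toCoeffs, EmbeddingLike.apply_eq_iff_eq]
  ext y
  constructor
  · rintro ⟨x, hx, rfl⟩
    rw [AlgHom.toLinearMap_apply, ← toCoeffs_symm_eq]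
    obtain ⟨h1, h2⟩ := (key ((toCoeffs d).symm x)).mp (by rwa [AlgEquiv.apply_symm_apply])
    exact ⟨⟨_, h1⟩, fun γ => Subtype.ext (h2 γ), rfl⟩
  · rintro ⟨⟨y, h1⟩, h2, rfl⟩
    refine ⟨toCoeffs d y, (key y).mpr ⟨h1, fun γ => congrArg Subtype.val (h2 γ)⟩, ?_⟩
    rw [AlgHom.toLinearMap_apply, ← toCoeffs_symm_eq, AlgEquiv.symm_apply_apply]
    rfl

theorem finrank_kerD_eq_finrank_invariants {p : ℕ} (hp : 2 * p = d * g) :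
    Module.finrank ℂ (kerD g p d) = Module.finrank ℂ (plethysmRep g d).invariants := by
  have hinj : Function.Injective (ofCoeffs d).toLinearMap := fun x y h => by
    rw [AlgHom.toLinearMap_apply, AlgHom.toLinearMap_apply, ← toCoeffs_symm_eq,
      ← toCoeffs_symm_eq] at h
    exact (toCoeffs d).symm.injective h
  rw [(Submodule.equivMapOfInjective _ hinj (kerD g p d)).finrank_eq, map_kerD_eq_invariants hp]
  exact (Submodule.equivMapOfInjective _ (Submodule.subtype_injective _) _).finrank_eq.symm

end Invariants

end CayleySylvester

end

theorem mainTheorem2 (g d : ℕ) :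
    -- (i) the dimension of the kernel of `D` in weight `p ≤ dg/2`
    (∀ p : ℕ, 2 * p ≤ d * g →
      (Module.finrank ℂ (kerD g p d) : ℚ) = PowerSeries.coeff p (csSeries g d)) ∧
    -- (ii) for `p = dg/2` the kernel of `D` is the space of invariants of degree `g`
    (∀ p : ℕ, 2 * p = d * g →
      (kerD g p d).map (ofCoeffs d).toLinearMap =
          (plethysmRep g d).invariants.map (symPow g (SymC2 d)).subtype ∧
        Module.finrank ℂ (kerD g p d) = Module.finrank ℂ (plethysmRep g d).invariants ∧
        (Module.finrank ℂ (plethysmRep g d).invariants : ℚ) =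
          PowerSeries.coeff p (csSeries g d)) ∧
    -- (iii) the decomposition of `S^g (S^d ℂ²)` under `SL(2, ℂ)`
    Nonempty ((plethysmRep g d).Equiv
      (Representation.directSum fun e : Exponent g d =>
        (symC2Rep e).tprod
          (Representation.trivial ℂ SL(2, ℂ) (kerD g ((d * g - e) / 2) d)))) ∧
    (∀ e : Exponent g d,
      (Module.finrank ℂ (kerD g ((d * g - e) / 2) d) : ℚ) =
        PowerSeries.coeff ((d * g - e) / 2) (csSeries g d)) := by
  refine ⟨fun p hp => finrank_kerD hp, fun p hp => ⟨map_kerD_eq_invariants hp,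
    finrank_kerD_eq_finrank_invariants hp, ?_⟩, nonempty_plethysm_equiv g d, fun e => ?_⟩
  · rw [← finrank_kerD_eq_finrank_invariants hp]
    exact finrank_kerD hp.le
  · have := two_mul_add_exponent e
    exact finrank_kerD (by lia)
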